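/- Let $\mathcal H$ be a complex Hilbert space of dimension $n$ and let $\widetilde P=\{p_i,|\psi_i\rangle\langle\psi_i|\}_{i=1}^n$ be an ensemble of $n$ linearly independent unit vectors $\psi_i\in\mathcal H$ with $p_i>0$, $\sum_i p_i=1$. Its Gram matrix is $G_{ij}=\sqrt{p_ip_j}\,\langle\psi_i|\psi_j\rangle$. Put $\widetilde\psi_i=\sqrt{p_i}\,\psi_i$ and let $\widetilde u_j$ be the vectors with $\langle\widetilde\psi_i|\widetilde u_j\rangle=\delta_{ij}$. A POVM $\{E_i\}_{i=1}^n$ (with $E_i\ge0$, $\sum_iE_i=\mathbb 1$) is optimal for $\widetilde P$ if it maximises $\sum_i p_i\langle\psi_i|E_i|\psi_i\rangle$ among all $n$-element POVMs. Let $\mathcal G$ be the set of positive definite complex $n\times n$ matrices of trace one. For $G_q\in\mathcal G$ with diagonal entries $q_i$ put $$C(G_q)=\Big(\sum_{j}\frac{q_j}{(G_q^{1/2})_{jj}}\Big)^{-1},\qquad p'_i=C(G_q)\,\frac{q_i}{(G_q^{1/2})_{ii}},\qquad \mathscr R_{\mathcal G}^{-1}(G_q)_{ij}=\sqrt{p'_ip'_j}\;\frac{(G_q)_{ij}}{\sqrt{q_iq_j}}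 .$$ A rank-one projective solution is an orthonormal basis $\{w_i\}$ of $\mathcal H$ together with a unitary matrix $W$ such that $w_i=\sum_j(G^{1/2}W)_{ji}\,\widetilde u_j$, the phases of the $w_i$ are fixed so that the diagonal entries $d_i=(G^{1/2}W)_{ii}$ are real and nonnegative, and $E_i=|w_i\rangle\langle w_i|$ satisfies the complementary slackness conditions $E_j\big(p_j|\psi_j\rangle\langle\psi_j|-p_i|\psi_i\rangle\langle\psi_i|\big)E_i=0$ for all $i,j$. Put $D=\mathrm{Diag}(d_1,\dots,d_n)$ and $X=DG^{1/2}W$. Then: 1. $\mathscr R_{\mathcal G}^{-1}$ is a bijection of $\mathcal G$ onto $\mathcal G$; denote its inverse by $\mathscr R_{\mathcal G}$. The ensemble $\widetilde P$ has exactly one optimal POVM, and it is $\{|w_i\rangle\langle w_i|\}$ for some rank-one projective solution. 2. For every rank-one projective solution, $X$ is Hermitian, $D^2$ is the diagonal of $X$, and $X^2=DGD$. The measurement $\{|w_i\rangle\langle w_i|\}$ is optimal for $\widetilde P$ if and only if $X$ is positive definite. In that case there is an ensemble $\widetilde Q=\{q_i,|\psi_i\rangle\langle\psi_i|\}_{i=1}^n$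 of the same states, with $q_i>0$ and $\sum_iq_i=1$, whose Gram matrix is $G_q=\mathscr R_{\mathcal G}(G)$ and whose pretty good measurement $\{\rho_q^{-1/2}q_i|\psi_i\rangle\langle\psi_i|\rho_q^{-1/2}\}$, $\rho_q=\sum_iq_i|\psi_i\rangle\langle\psi_i|$, equals $\{|w_i\rangle\langle w_i|\}$. Moreover $X=C\,G_q^{1/2}$ with $C=C(G_q)>0$, and $$\mathscr R_{\mathcal G}(G)=\frac{DGD}{\mathrm{Tr}(D^2G)} .$$ 3. Let $X$ be any Hermitian matrix with $X^2=DGD$, where $D$ is a diagonal matrix with real nonnegative entries and $D^2$ is the diagonal of $X$. Then $X$ is positive definite if and only if it arises as in 2 from a rank-one projective solution whose measurement is optimal for $\widetilde P$; in that case $\mathscr R_{\mathcal G}(G)=DGD/\mathrm{Tr}(D^2G)$. -/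

import Mathlib

open scoped ComplexOrder MatrixOrder

noncomputable section

namespace MED

/-- An ensemble `{p i, |ψ i⟩⟨ψ i|}` of `n` linearly independent pure states which span the Hilbert
space `H` (so `H` has dimension `n`), with strictly positive a priori probabilities. -/
structure Ensemble (n : ℕ) (H : Type*) [NormedAddCommGroup H] [InnerProductSpace ℂ H] where
  p : Fin n → ℝ
  ψ : Fin n → H
  p_pos : ∀ i, 0 < p i
  p_sum : ∑ i, p i = 1
  norm_ψ : ∀ i, ‖ψ i‖ = 1
  indep : LinearIndependent ℂ ψ
  span_top : Submodule.span ℂ (Set.range ψ) = ⊤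

/-- The positive semidefinite square root of a positive semidefinite matrix. -/
def msqrt {n : ℕ} (M : Matrix (Fin n) (Fin n) ℂ) : Matrix (Fin n) (Fin n) ℂ := CFC.sqrt M

section Hilbert

variable {n : ℕ} {H : Type*} [NormedAddCommGroup H] [InnerProductSpace ℂ H]

/-- The operator `|v⟩⟨v|`. -/
def ketbra (v : H) : H →L[ℂ] H := InnerProductSpace.rankOne ℂ v v

/-- The subnormalised state `√(p i) |ψ i⟩`. -/
def Ensemble.tilde (P : Ensemble n H) (i : Fin n) : H := (√(P.p i) : ℂ) • P.ψ i

/-- The Gram matrix `G i j = √(p i) √(p j) ⟨ψ i|ψ j⟩`. -/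
def Ensemble.gram (P : Ensemble n H) : Matrix (Fin n) (Fin n) ℂ := Matrix.gram ℂ P.tilde

/-- The vectors `u j` biorthogonal to the vectors `√(p i) |ψ i⟩`; see `Ensemble.inner_tilde_u`. -/
def Ensemble.u (P : Ensemble n H) (j : Fin n) : H := ∑ k, P.gram⁻¹ k j • P.tilde k

theorem Ensemble.gram_posDef (P : Ensemble n H) : P.gram.PosDef := by
  apply Matrix.posDef_gram_of_linearIndependent
  have h := P.indep.units_smul (fun i => Units.mk0 (√(P.p i) : ℂ) (by
    have := Real.sqrt_pos.2 (P.p_pos i)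
    exact_mod_cast this.ne'))
  exact h

theorem Ensemble.inner_tilde_u (P : Ensemble n H) (i j : Fin n) :
    inner ℂ (P.tilde i) (P.u j) = if i = j then 1 else 0 := by
  have h : P.gram * P.gram⁻¹ = 1 :=
    Matrix.mul_nonsing_inv _ ((Matrix.isUnit_iff_isUnit_det _).1 P.gram_posDef.isUnit)
  have h2 := congrFun (congrFun h i) j
  rw [Matrix.mul_apply, Matrix.one_apply] at h2
  rw [← h2, Ensemble.u, inner_sum]
  refine Finset.sum_congr rfl fun k _ => ?_
  rw [inner_smul_right, mul_comm]
  rfl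

/-- `n`-element positive operator valued measures on `H`. -/
def IsPOVM (E : Fin n → H →L[ℂ] H) : Prop :=
  (∀ i, (E i).IsPositive) ∧ ∑ i, E i = 1

/-- The average probability of success `∑ i, p i ⟨ψ i|E i|ψ i⟩`. -/
def Ensemble.successProb (P : Ensemble n H) (E : Fin n → H →L[ℂ] H) : ℝ :=
  ∑ i, P.p i * (inner ℂ (P.ψ i) (E i (P.ψ i))).re

/-- `E` is optimal for minimum error discrimination of `P`: it maximises the average probability
of success among all `n`-element POVMs. -/
def Ensemble.IsOptimal (P : Ensemble n H) (E : Fin n → H →L[ℂ] H) : Prop :=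
  IsPOVM E ∧ ∀ F : Fin n → H →L[ℂ] H, IsPOVM F → P.successProb F ≤ P.successProb E

/-- The complementary slackness conditions
`E j (p j |ψ j⟩⟨ψ j| - p i |ψ i⟩⟨ψ i|) E i = 0`. -/
def Ensemble.Slack (P : Ensemble n H) (E : Fin n → H →L[ℂ] H) : Prop :=
  ∀ i j, E j * ((P.p j : ℂ) • ketbra (P.ψ j) - (P.p i : ℂ) • ketbra (P.ψ i)) * E i = 0

/-- The rank-one projective measurement of an orthonormal basis. -/
def proj (w : OrthonormalBasis (Fin n) ℂ H) (i : Fin n) : H →L[ℂ] H := ketbra (w i)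

/-- The density operator `∑ i, p i |ψ i⟩⟨ψ i|`. -/
def Ensemble.density (P : Ensemble n H) : H →L[ℂ] H := ∑ i, (P.p i : ℂ) • ketbra (P.ψ i)

/-- The pretty good measurement `ρ^(-1/2) (p i |ψ i⟩⟨ψ i|) ρ^(-1/2)`. -/
def Ensemble.pgm [CompleteSpace H] (P : Ensemble n H) (i : Fin n) : H →L[ℂ] H :=
  Ring.inverse (CFC.sqrt P.density) * ((P.p i : ℂ) • ketbra (P.ψ i)) *
    Ring.inverse (CFC.sqrt P.density)

/-- `w` is an orthonormal basis whose rank-one projective measurement solves the complementary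
slackness conditions, `W` is the unitary matrix which represents it,
`w i = ∑ j, (G^(1/2) W) j i • u j`, and the phases of the `w i` are fixed so that the diagonal of
`G^(1/2) W` is real and nonnegative. -/
structure Ensemble.IsProjSolution (P : Ensemble n H) (w : OrthonormalBasis (Fin n) ℂ H)
    (W : Matrix (Fin n) (Fin n) ℂ) : Prop where
  unitary : W ∈ Matrix.unitaryGroup (Fin n) ℂ
  repr : ∀ i, w i = ∑ j, (msqrt P.gram * W) j i • P.u j
  diag_im : ∀ i, ((msqrt P.gram * W) i i).im = 0
  diag_re : ∀ i, 0 ≤ ((msqrt P.gram * W) i i).re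
  slack : P.Slack (proj w)

/-- The diagonal matrix `D` with the diagonal of `G^(1/2) W`. -/
def Ensemble.D (P : Ensemble n H) (W : Matrix (Fin n) (Fin n) ℂ) : Matrix (Fin n) (Fin n) ℂ :=
  Matrix.diagonal fun i => (msqrt P.gram * W) i i

/-- `X = D G^(1/2) W`. -/
def Ensemble.X (P : Ensemble n H) (W : Matrix (Fin n) (Fin n) ℂ) : Matrix (Fin n) (Fin n) ℂ :=
  P.D W * msqrt P.gram * W

end Hilbert

section Gram

variable {n : ℕ}

/-- Positive definite matrices of trace one. -/
def gramSet (n : ℕ) : Set (Matrix (Fin n) (Fin n) ℂ) := {M | M.PosDef ∧ M.trace = 1}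

/-- `C = (∑ j, q j / (G_q^(1/2)) j j)⁻¹`, where `q j = (G_q) j j`. -/
def normConst (Gq : Matrix (Fin n) (Fin n) ℂ) : ℝ :=
  (∑ j, (Gq j j).re / (msqrt Gq j j).re)⁻¹

/-- `p i = C q i / (G_q^(1/2)) i i`. -/
def priorOf (Gq : Matrix (Fin n) (Fin n) ℂ) (i : Fin n) : ℝ :=
  normConst Gq * ((Gq i i).re / (msqrt Gq i i).re)

/-- The map `G_q ↦ G` which keeps the states and replaces the probabilities `q i` by
`p i = C q i / (G_q^(1/2)) i i`:
`G i j = √(p i p j) ⟨ψ i|ψ j⟩` with `⟨ψ i|ψ j⟩ = (G_q) i j / √(q i q j)`. -/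
def RGinv (Gq : Matrix (Fin n) (Fin n) ℂ) : Matrix (Fin n) (Fin n) ℂ :=
  Matrix.of fun i j =>
    (√(priorOf Gq i * priorOf Gq j) : ℂ) * (Gq i j / (√((Gq i i).re * (Gq j j).re) : ℂ))

/-- The map `R_G` on the positive definite matrices of trace one: the inverse of `RGinv` there. -/
def RG : Matrix (Fin n) (Fin n) ℂ → Matrix (Fin n) (Fin n) ℂ :=
  Function.invFunOn RGinv (gramSet n)

/-- `X` is a Hermitian solution of `X² = D G D`, where `D = diag (d i)` is the nonnegative square
root of the diagonal of `X`. -/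
structure IsMatrixSolution (G X : Matrix (Fin n) (Fin n) ℂ) (d : Fin n → ℝ) : Prop where
  herm : X.IsHermitian
  nonneg : ∀ i, 0 ≤ d i
  diag : ∀ i, X i i = (d i : ℂ) ^ 2
  eq : X * X = Matrix.diagonal (fun i => (d i : ℂ)) * G * Matrix.diagonal (fun i => (d i : ℂ))

end Gram

end MED

end

/-! Everything rests on one fact: for positive definite `G` there is exactly one positive definite
`X` with `X² = DGD`, where `D²` is the diagonal of `X`. Substituting `X = DTD` turns this into `T D²
T = G` with `T` of unit diagonal, that is, `T⁻¹ G T⁻¹` must be diagonal. This is the stationarity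
condition for minimising `Tr (T⁻¹ G)` over positive definite matrices of unit diagonal. A
compactness argument gives a minimiser (`exists_correlation_diagonal`), and a trace identity gives
uniqueness (`correlation_unique`).

Such solutions `X` are the positive multiples `C √Q`: `C(Q) √Q` solves the equation for `RGinv Q`,
and conversely `X² / Tr X²` is a preimage of `G`. Existence and uniqueness of `X` thus give
surjectivity and injectivity of `RGinv`, and the formula for `RG`.

For discrimination, the matrix `D⁻¹X` yields a basis `w` solving the slackness conditions
(`exists_isProjSolution`). In that basis `X` is a feasible point of the dual semidefinite program:
it dominates every weighted state (`posSemidef_sub_of_diag`). Weak duality gives optimality, and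
vanishing of the duality gap forces an optimal POVM to be that of `w`. A projective solution with
optimal measurement therefore has the same measurement as the positive definite one, and the phase
convention makes their matrices `X` equal (`posDef_of_isOptimal`). Finally, `X / c` is the matrix of
the square root of the density operator of the reweighted ensemble, which identifies the pretty good
measurement. -/

noncomputable section

namespace MED

/-! ### Positive semidefinite matrices and the trace form -/

section PosSemidef

open Matrix

variable {n : ℕ}

theorem msqrt_posSemidef (A : Matrix (Fin n) (Fin n) ℂ) : (msqrt A).PosSemidef :=
  (CFC.sqrt_nonneg A).posSemidef

theorem msqrt_mul_self {A : Matrix (Fin n) (Fin n) ℂ} (hA : A.PosSemidef) :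
    msqrt A * msqrt A = A :=
  CFC.sqrt_mul_sqrt_self A hA.nonneg

theorem msqrt_unique {A B : Matrix (Fin n) (Fin n) ℂ} (hB : B.PosSemidef) (h : B * B = A) :
    msqrt A = B :=
  CFC.sqrt_unique h hB.nonneg

theorem msqrt_posDef {A : Matrix (Fin n) (Fin n) ℂ} (hA : A.PosDef) : (msqrt A).PosDef := by
  rw [(msqrt_posSemidef A).posDef_iff_isUnit]
  have h := hA.isUnit
  rw [← msqrt_mul_self hA.posSemidef] at h
  exact isUnit_of_mul_isUnit_left h

theorem trace_mul_re_nonneg {A B : Matrix (Fin n) (Fin n) ℂ} (hA : A.PosSemidef)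
    (hB : B.PosSemidef) : 0 ≤ (A * B).trace.re := by
  have h := (hB.conjTranspose_mul_mul_same (msqrt A)).trace_nonneg
  rw [(msqrt_posSemidef A).1, Matrix.mul_assoc, Matrix.trace_mul_comm, Matrix.mul_assoc,
    msqrt_mul_self hA, Matrix.trace_mul_comm] at h
  exact (Complex.le_def.1 h).1

/-- Positive semidefinite matrices which are orthogonal for the trace form have product zero. -/
theorem mul_eq_zero_of_trace_mul_eq_zero {A B : Matrix (Fin n) (Fin n) ℂ} (hA : A.PosSemidef)
    (hB : B.PosSemidef) (h : (A * B).trace.re = 0) : A * B = 0 := by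
  have key : ((msqrt B * msqrt A)ᴴ * (msqrt B * msqrt A)) = msqrt A * B * msqrt A := by
    rw [conjTranspose_mul, (msqrt_posSemidef A).1, (msqrt_posSemidef B).1]
    simp only [Matrix.mul_assoc]
    rw [← Matrix.mul_assoc (msqrt B) (msqrt B), msqrt_mul_self hB]
  have ht : (msqrt A * B * msqrt A).trace = (A * B).trace := by
    rw [Matrix.trace_mul_comm, ← Matrix.mul_assoc, msqrt_mul_self hA]
  have h0 : (msqrt A * B * msqrt A).trace = 0 := by
    have h1 := (posSemidef_conjTranspose_mul_self (msqrt B * msqrt A)).trace_nonneg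
    rw [key] at h1
    refine Complex.ext (by rw [ht, h]; rfl) (Complex.le_def.1 h1).2.symm
  rw [← key, trace_conjTranspose_mul_self_eq_zero_iff] at h0
  have h2 : msqrt A * msqrt B = 0 := by
    have := congrArg conjTranspose h0
    rwa [conjTranspose_mul, (msqrt_posSemidef A).1, (msqrt_posSemidef B).1,
      conjTranspose_zero] at this
  calc A * B = msqrt A * (msqrt A * msqrt B) * msqrt B := by
        rw [← Matrix.mul_assoc, msqrt_mul_self hA, Matrix.mul_assoc, msqrt_mul_self hB]
    _ = 0 := by rw [h2]; simp

/-- The trace is the squared Hilbert–Schmidt norm of `√B E √A`, so it is definite in `E`. The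
invertible factors `A` and `B` are stripped off in turn, leaving `E² = 0`. -/
theorem eq_zero_of_trace_eq_zero {A B E : Matrix (Fin n) (Fin n) ℂ} (hA : A.PosDef)
    (hB : B.PosDef) (hE : E.IsHermitian) (h : (E * B * E * A).trace.re = 0) : E = 0 := by
  have h1 : (E * B * E).PosSemidef := by
    have := hB.posSemidef.conjTranspose_mul_mul_same E
    rwa [hE] at this
  have h2 := mul_eq_zero_of_trace_mul_eq_zero h1 hA.posSemidef h
  have h3 : E * B * E = 0 := by
    have := congrArg (· * A⁻¹) h2
    simpa [Matrix.mul_assoc, Matrix.mul_nonsing_inv _ ((isUnit_iff_isUnit_det _).1 hA.isUnit)]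
      using this
  have h4 : (E * E).PosSemidef := by
    have := posSemidef_conjTranspose_mul_self E
    rwa [hE] at this
  have h5 := mul_eq_zero_of_trace_mul_eq_zero h4 hB.posSemidef (by
    rw [Matrix.mul_assoc, Matrix.trace_mul_comm, h3]; simp)
  have h6 : E * E = 0 := by
    have := congrArg (· * B⁻¹) h5
    simpa [Matrix.mul_assoc, Matrix.mul_nonsing_inv _ ((isUnit_iff_isUnit_det _).1 hB.isUnit)]
      using this
  rw [← conjTranspose_mul_self_eq_zero, hE, h6]

/-- A positive semidefinite matrix is bounded above by its trace. -/
theorem posSemidef_trace_smul_one_sub {A : Matrix (Fin n) (Fin n) ℂ} (hA : A.PosSemidef) :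
    (A.trace • (1 : Matrix (Fin n) (Fin n) ℂ) - A).PosSemidef := by
  have hAt : star A.trace = A.trace := by rw [← trace_conjTranspose, hA.1]
  refine PosSemidef.of_dotProduct_mulVec_nonneg ?_ fun x => ?_
  · rw [IsHermitian, conjTranspose_sub, conjTranspose_smul, hAt, conjTranspose_one, hA.1]
  · have hsum : ∀ v : Fin n → ℂ, star v ⬝ᵥ v = ((∑ i, ‖v i‖ ^ 2 : ℝ) : ℂ) := by
      intro v
      simp only [dotProduct, Pi.star_apply, RCLike.star_def, Complex.ofReal_sum]
      refine Finset.sum_congr rfl fun i _ => ?_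
      rw [← Complex.normSq_eq_conj_mul_self, Complex.normSq_eq_norm_sq]
    set S := msqrt A with hS
    have hSh : Sᴴ = S := (msqrt_posSemidef A).1
    have hq : star x ⬝ᵥ A *ᵥ x = ((∑ i, ‖(S *ᵥ x) i‖ ^ 2 : ℝ) : ℂ) := by
      rw [← hsum, star_mulVec, hSh, ← dotProduct_mulVec, mulVec_mulVec, msqrt_mul_self hA]
    have htr : A.trace = ((∑ i, ∑ j, ‖S i j‖ ^ 2 : ℝ) : ℂ) := by
      have : A = S * Sᴴ := by rw [hSh, msqrt_mul_self hA]
      rw [this]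
      simp only [trace, diag_apply, mul_apply, conjTranspose_apply, RCLike.star_def,
        Complex.ofReal_sum]
      refine Finset.sum_congr rfl fun i _ => Finset.sum_congr rfl fun j _ => ?_
      rw [Complex.mul_conj, Complex.normSq_eq_norm_sq]
    rw [sub_mulVec, dotProduct_sub, smul_mulVec, one_mulVec, dotProduct_smul, hq, hsum, htr,
      smul_eq_mul, ← Complex.ofReal_mul, ← Complex.ofReal_sub, Complex.zero_le_real, sub_nonneg,
      Finset.sum_mul]
    refine Finset.sum_le_sum fun i _ => ?_
    calc ‖(S *ᵥ x) i‖ ^ 2 ≤ (∑ j, ‖S i j‖ * ‖x j‖) ^ 2 := by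
          gcongr
          refine (norm_sum_le Finset.univ fun j => S i j * x j).trans (Finset.sum_le_sum fun j _ => ?_)
          rw [norm_mul]
      _ ≤ _ := Finset.sum_mul_sq_le_sq_mul_sq _ _ _

theorem posSemidef_trace_inv_smul_sub_one {A : Matrix (Fin n) (Fin n) ℂ} (hA : A.PosDef) :
    (A⁻¹.trace • A - 1).PosSemidef := by
  have h := (posSemidef_trace_smul_one_sub hA.inv.posSemidef).conjTranspose_mul_mul_same (msqrt A)
  have hS : (msqrt A)ᴴ = msqrt A := (msqrt_posSemidef A).1
  have hu : IsUnit (msqrt A).det := (isUnit_iff_isUnit_det _).1 (msqrt_posDef hA).isUnit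
  have hi : A⁻¹ = (msqrt A)⁻¹ * (msqrt A)⁻¹ := by
    conv_lhs => rw [← msqrt_mul_self hA.posSemidef, Matrix.mul_inv_rev]
  have : msqrt A * A⁻¹ * msqrt A = 1 := by
    rw [hi, ← Matrix.mul_assoc, mul_nonsing_inv _ hu, Matrix.one_mul, nonsing_inv_mul _ hu]
  rwa [hS, Matrix.mul_sub, Matrix.sub_mul, this, Matrix.mul_smul, Matrix.smul_mul, Matrix.mul_one,
    msqrt_mul_self hA.posSemidef] at h

/-- A Hermitian matrix is bounded below by a negative multiple of the identity. -/
theorem exists_posSemidef_smul_one_add {V : Matrix (Fin n) (Fin n) ℂ} (hV : V.IsHermitian) :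
    ∃ r : ℝ, 0 < r ∧ ((r : ℂ) • (1 : Matrix (Fin n) (Fin n) ℂ) + V).PosSemidef := by
  have h1 : (V * V).PosSemidef := by
    have := posSemidef_conjTranspose_mul_self V
    rwa [hV] at this
  have h2 := posSemidef_trace_smul_one_sub h1
  have h3 : ((1 + V) * (1 + V)).PosSemidef := by
    have := posSemidef_conjTranspose_mul_self (1 + V)
    rwa [conjTranspose_add, hV, conjTranspose_one] at this
  -- In `(Tr V² - V²) + (1 + V)²` the squares cancel, leaving `(Tr V² + 1) + 2V`; halving gives the
  -- constant `r`.
  have h4 := (h2.add h3).smul (show (0 : ℂ) ≤ ((2⁻¹ : ℝ) : ℂ) by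
    rw [Complex.zero_le_real]; norm_num)
  have htr := Complex.le_def.1 h1.trace_nonneg
  have ht : (V * V).trace = (((V * V).trace.re : ℝ) : ℂ) :=
    Complex.ext rfl (by simpa using htr.2.symm)
  refine ⟨((V * V).trace.re + 1) / 2, by
    have : 0 ≤ (V * V).trace.re := htr.1
    positivity, ?_⟩
  convert h4 using 1
  rw [ht]
  ext i j
  simp [Matrix.add_mul, Matrix.mul_add]
  ring

theorem isClosed_posSemidef : IsClosed {A : Matrix (Fin n) (Fin n) ℂ | A.PosSemidef} := by
  simp only [posSemidef_iff_dotProduct_mulVec, Set.ofPred_and, Set.ofPred_forall, IsHermitian]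
  refine (isClosed_eq (by fun_prop) continuous_id).inter (isClosed_iInter fun x => ?_)
  exact isClosed_le continuous_const (by fun_prop)

end PosSemidef

/-! ### Minimising `Tr (T⁻¹ G)` over correlation matrices -/

section Correlation

open Matrix

variable {n : ℕ}

theorem posDef_isUnit_det {A : Matrix (Fin n) (Fin n) ℂ} (hA : A.PosDef) : IsUnit A.det :=
  (isUnit_iff_isUnit_det _).1 hA.isUnit

/-- The positive semidefinite matrices with unit diagonal which are bounded below by `c⁻¹`. -/
def correlationSet (n : ℕ) (c : ℝ) : Set (Matrix (Fin n) (Fin n) ℂ) :=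
  {T | T.PosSemidef ∧ (∀ i, T i i = 1) ∧ ((c : ℂ) • T - 1).PosSemidef}

theorem correlationSet_posDef {c : ℝ} {T : Matrix (Fin n) (Fin n) ℂ}
    (hT : T ∈ correlationSet n c) : T.PosDef := by
  rw [hT.1.posDef_iff_isUnit]
  have h := (PosDef.posSemidef_add hT.2.2 PosDef.one).isUnit
  rw [sub_add_cancel, isUnit_iff_isUnit_det, det_smul] at h
  exact (isUnit_iff_isUnit_det _).2 (isUnit_of_mul_isUnit_right h)

/-- The rows of `√T` have norm one because `T` has unit diagonal. The set is thus a closed part of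
the image, under `B ↦ B Bᴴ`, of the matrices with entries in the closed unit disc. -/
theorem isCompact_correlationSet (c : ℝ) : IsCompact (correlationSet n c) := by
  have hK : IsCompact (Set.matrix (Metric.closedBall (0 : ℂ) 1) :
      Set (Matrix (Fin n) (Fin n) ℂ)) := (isCompact_closedBall _ _).matrix
  have hI := hK.image (f := fun B : Matrix (Fin n) (Fin n) ℂ => B * Bᴴ) (by fun_prop)
  refine hI.of_isClosed_subset ?_ ?_
  · have : correlationSet n c = {T | T.PosSemidef} ∩ ((⋂ i, {T | T i i = 1}) ∩
        (fun T => (c : ℂ) • T - 1) ⁻¹' {T | T.PosSemidef}) := by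
      ext T
      simp [correlationSet]
    rw [this]
    refine isClosed_posSemidef.inter (IsClosed.inter ?_ ?_)
    · exact isClosed_iInter fun i => isClosed_eq (by fun_prop) continuous_const
    · exact isClosed_posSemidef.preimage (by fun_prop)
  · rintro T ⟨hT, hd, -⟩
    refine ⟨msqrt T, fun i j => ?_, ?_⟩
    · have h := congrFun (congrFun (msqrt_mul_self hT) i) i
      have hS : (msqrt T)ᴴ = msqrt T := (msqrt_posSemidef T).1
      rw [hd i] at h
      nth_rewrite 2 [← hS] at h
      rw [mul_apply] at h
      have h2 : ((∑ k, ‖msqrt T i k‖ ^ 2 : ℝ) : ℂ) = 1 := by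
        rw [← h, Complex.ofReal_sum]
        refine Finset.sum_congr rfl fun k _ => ?_
        rw [conjTranspose_apply, RCLike.star_def, Complex.mul_conj, Complex.normSq_eq_norm_sq]
      have h3 : ∑ k, ‖msqrt T i k‖ ^ 2 = 1 := by exact_mod_cast h2
      have h4 : ‖msqrt T i j‖ ^ 2 ≤ 1 := by
        rw [← h3]
        exact Finset.single_le_sum (f := fun k => ‖msqrt T i k‖ ^ 2)
          (fun k _ => by positivity) (Finset.mem_univ j)
      rw [mem_closedBall_zero_iff]
      exact (sq_le_one_iff₀ (norm_nonneg _)).1 h4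
    · change msqrt T * (msqrt T)ᴴ = T
      rw [(msqrt_posSemidef T).1, msqrt_mul_self hT]

theorem continuousAt_inv_of_posDef {T : Matrix (Fin n) (Fin n) ℂ} (hT : T.PosDef) :
    ContinuousAt (fun S : Matrix (Fin n) (Fin n) ℂ => S⁻¹) T := by
  refine continuousAt_matrix_inv T ?_
  rw [Ring.inverse_eq_inv']
  exact continuousAt_inv₀ (posDef_isUnit_det hT).ne_zero

theorem trace_eq_re {A : Matrix (Fin n) (Fin n) ℂ} (hA : A.PosSemidef) :
    A.trace = (A.trace.re : ℂ) :=
  Complex.ext rfl (by simpa using (Complex.le_def.1 hA.trace_nonneg).2.symm)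

theorem trace_re_nonneg {A : Matrix (Fin n) (Fin n) ℂ} (hA : A.PosSemidef) : 0 ≤ A.trace.re :=
  (Complex.le_def.1 hA.trace_nonneg).1

theorem smul_posSemidef {A : Matrix (Fin n) (Fin n) ℂ} (hA : A.PosSemidef) {r : ℝ} (hr : 0 ≤ r) :
    ((r : ℂ) • A).PosSemidef :=
  hA.smul (Complex.zero_le_real.2 hr)

/-- The sublevel sets of `T ↦ Tr (T⁻¹ G)` are bounded away from the singular matrices. -/
theorem posSemidef_smul_sub_one_of_trace_le {G T : Matrix (Fin n) (Fin n) ℂ} (hG : G.PosDef)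
    (hT : T.PosDef) (h : (T⁻¹ * G).trace.re ≤ G.trace.re) {c : ℝ}
    (hc : G⁻¹.trace.re * G.trace.re ≤ c) : ((c : ℂ) • T - 1).PosSemidef := by
  -- From `Tr G⁻¹ • G ≥ 1` follows `Tr T⁻¹ ≤ Tr G⁻¹ · Tr (T⁻¹ G) ≤ c`, and then `Tr T⁻¹ • T ≥ 1`
  -- gives the bound.
  have h1 := trace_mul_re_nonneg hT.inv.posSemidef (posSemidef_trace_inv_smul_sub_one hG)
  rw [trace_eq_re hG.inv.posSemidef, Matrix.mul_sub, Matrix.mul_smul, trace_sub, trace_smul,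
    Matrix.mul_one, Complex.sub_re, smul_eq_mul, Complex.re_ofReal_mul] at h1
  have h2 : T⁻¹.trace.re ≤ c := by
    nlinarith [mul_le_mul_of_nonneg_left h (trace_re_nonneg hG.inv.posSemidef)]
  have h3 := posSemidef_trace_inv_smul_sub_one hT
  rw [trace_eq_re hT.inv.posSemidef] at h3
  convert h3.add (smul_posSemidef hT.posSemidef (sub_nonneg.2 h2)) using 1
  rw [Complex.ofReal_sub, sub_smul]
  abel

/-- Small Hermitian perturbations with zero diagonal stay inside the correlation set. -/
theorem eventually_add_smul_mem_correlationSet {T V : Matrix (Fin n) (Fin n) ℂ} {c : ℝ}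
    (hc : 0 < c) (hd : ∀ i, T i i = 1)
    (hcT : ((c : ℂ) • T - 1).PosSemidef) (hV : V.IsHermitian) (hV0 : ∀ i, V i i = 0) :
    ∀ᶠ t : ℝ in nhdsWithin 0 (Set.Ioi 0), T + (t : ℂ) • V ∈ correlationSet n (c + 1) := by
  obtain ⟨r, hr, hrV⟩ := exists_posSemidef_smul_one_add hV
  -- `T + sV = c⁻¹(cT - 1) + (c⁻¹ - sr)1 + s(r + V)`, a sum of positive terms for small `s`.
  have key : ∀ s : ℝ, 0 ≤ s → s * r ≤ c⁻¹ → (T + (s : ℂ) • V).PosSemidef := by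
    intro s hs hsr
    have h1 := smul_posSemidef hcT (inv_nonneg.2 hc.le)
    have h2 := smul_posSemidef (PosSemidef.one (n := Fin n) (R := ℂ)) (sub_nonneg.2 hsr)
    convert (h1.add h2).add (smul_posSemidef hrV hs) using 1
    have hc' : (c : ℂ) ≠ 0 := by exact_mod_cast hc.ne'
    rw [smul_sub, smul_smul, smul_add, smul_smul]
    push_cast
    rw [inv_mul_cancel₀ hc', one_smul, sub_smul]
    abel
  have hlim : ∀ b : ℝ, ∀ᶠ t : ℝ in nhdsWithin 0 (Set.Ioi 0), t * b * r ≤ c⁻¹ := by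
    intro b
    have : Filter.Tendsto (fun t : ℝ => t * b * r) (nhds 0) (nhds (0 * b * r)) := by
      apply Continuous.tendsto; fun_prop
    rw [zero_mul, zero_mul] at this
    exact (this.mono_left nhdsWithin_le_nhds).eventually_le_const (inv_pos.2 hc)
  filter_upwards [hlim 1, hlim (c + 1), self_mem_nhdsWithin] with t h1 h2 ht
  have ht : 0 < t := ht
  refine ⟨key t ht.le (by simpa using h1), fun i => by simp [hd, hV0], ?_⟩
  -- `(c + 1)(T + tV) - 1 = (cT - 1) + (T + t(c + 1)V)`: the extra `T` absorbs the perturbation.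
  convert hcT.add (key (t * (c + 1)) (by positivity) h2) using 1
  push_cast
  rw [smul_add, add_smul, smul_smul, one_smul, mul_comm (t : ℂ)]
  abel

/-- First order optimality: the minimiser of `T ↦ Tr (T⁻¹ G)` over the correlation matrices
diagonalises `T⁻¹ G T⁻¹`. -/
theorem exists_correlation_diagonal {G : Matrix (Fin n) (Fin n) ℂ} (hG : G.PosDef) :
    ∃ (T : Matrix (Fin n) (Fin n) ℂ) (l : Fin n → ℝ), T.PosDef ∧ (∀ i, T i i = 1) ∧
      (∀ i, 0 < l i) ∧ T⁻¹ * G * T⁻¹ = diagonal fun i => (l i : ℂ) := by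
  -- Minimisation takes place with bound `c + 1`, while comparison with `T = 1` shows that the
  -- minimiser satisfies the stricter bound `c`. The lower bound is thus not active, and small
  -- admissible perturbations remain in the set.
  set c : ℝ := G⁻¹.trace.re * G.trace.re + 1 with hcdef
  have hc0 : 0 ≤ G⁻¹.trace.re * G.trace.re :=
    mul_nonneg (trace_re_nonneg hG.inv.posSemidef) (trace_re_nonneg hG.posSemidef)
  have hc : 0 < c := by positivity
  have hone : (1 : Matrix (Fin n) (Fin n) ℂ) ∈ correlationSet n (c + 1) := by
    refine ⟨PosSemidef.one, fun i => one_apply_eq i, ?_⟩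
    convert smul_posSemidef (PosSemidef.one (n := Fin n) (R := ℂ)) hc.le using 1
    push_cast
    rw [add_smul, one_smul, add_sub_cancel_right]
  have hcont : ContinuousOn (fun T : Matrix (Fin n) (Fin n) ℂ => (T⁻¹ * G).trace.re)
      (correlationSet n (c + 1)) := by
    intro T hT
    have h1 := continuousAt_inv_of_posDef (correlationSet_posDef hT)
    have h2 : Continuous fun S : Matrix (Fin n) (Fin n) ℂ => (S * G).trace.re := by fun_prop
    exact (h2.continuousAt.comp h1).continuousWithinAt
  obtain ⟨T, hTm, hmin⟩ := (isCompact_correlationSet (c + 1)).exists_isMinOn ⟨1, hone⟩ hcont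
  have hT := correlationSet_posDef hTm
  have hTu := posDef_isUnit_det hT
  have hle : (T⁻¹ * G).trace.re ≤ G.trace.re := by
    have := hmin hone
    simpa using this
  have hcT := posSemidef_smul_sub_one_of_trace_le hG hT hle (c := c) (by linarith)
  set M := T⁻¹ * G * T⁻¹ with hM
  have hMpd : M.PosDef := by
    have := hG.conjTranspose_mul_mul_same (B := T⁻¹)
      (mulVec_injective_of_isUnit hT.inv.isUnit)
    rwa [hT.inv.1] at this
  -- The off-diagonal part of `M` is the test direction: it preserves the unit diagonal, and the
  -- derivative of `Tr ((T + tV)⁻¹ G)` at `0` is `-Tr (VM) = -Tr V²`. Minimality therefore forces `V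
  -- = 0`.
  set V : Matrix (Fin n) (Fin n) ℂ := M - diagonal M.diag with hVdef
  have hV0 : ∀ i, V i i = 0 := fun i => by simp [hVdef]
  have hVh : V.IsHermitian := by
    refine hMpd.1.sub (isHermitian_diagonal_iff.2 fun i => ?_)
    exact hMpd.1.apply i i
  have hle0 : (V * M).trace.re ≤ 0 := by
    have hlim : Filter.Tendsto (fun t : ℝ => (T⁻¹ * V * (T + (t : ℂ) • V)⁻¹ * G).trace.re)
        (nhdsWithin 0 (Set.Ioi 0)) (nhds (T⁻¹ * V * T⁻¹ * G).trace.re) := by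
      have h1 : Filter.Tendsto (fun t : ℝ => T + (t : ℂ) • V) (nhds 0) (nhds T) := by
        have : Continuous fun t : ℝ => T + (t : ℂ) • V := by fun_prop
        simpa using this.tendsto 0
      have h2 := (continuousAt_inv_of_posDef hT).tendsto.comp h1
      have h3 : Continuous fun S : Matrix (Fin n) (Fin n) ℂ => (T⁻¹ * V * S * G).trace.re := by
        fun_prop
      exact ((h3.tendsto _).comp h2).mono_left nhdsWithin_le_nhds
    have hneg : (T⁻¹ * V * T⁻¹ * G).trace.re ≤ 0 := by
      refine le_of_tendsto hlim ?_
      filter_upwards [eventually_add_smul_mem_correlationSet hc hTm.2.1 hcT hVh hV0,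
        self_mem_nhdsWithin] with t hmem ht
      have ht : 0 < t := ht
      set S := T + (t : ℂ) • V with hS
      have hSu := posDef_isUnit_det (correlationSet_posDef hmem)
      have hres : (T⁻¹ - S⁻¹ : Matrix _ _ ℂ) = (t : ℂ) • (T⁻¹ * V * S⁻¹) := by
        have : (t : ℂ) • V = S - T := by simp [hS]
        rw [← Matrix.smul_mul, ← Matrix.mul_smul, this, Matrix.mul_sub, Matrix.sub_mul,
          nonsing_inv_mul _ hTu, Matrix.mul_assoc, mul_nonsing_inv _ hSu]
        simp
      have h4 : (T⁻¹ * G).trace.re - (S⁻¹ * G).trace.re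
          = t * (T⁻¹ * V * S⁻¹ * G).trace.re := by
        rw [← Complex.sub_re, ← trace_sub, ← Matrix.sub_mul, hres, Matrix.smul_mul, trace_smul,
          smul_eq_mul, Complex.re_ofReal_mul]
      have h5 : (T⁻¹ * G).trace.re ≤ (S⁻¹ * G).trace.re := hmin hmem
      by_contra hcon
      rw [not_le] at hcon
      have := mul_pos ht hcon
      linarith
    convert hneg using 2
    rw [hM, ← Matrix.mul_assoc, trace_mul_comm]
    simp only [Matrix.mul_assoc]
  have hVM : (V * M).trace = (Vᴴ * V).trace := by
    have hd : (V * diagonal M.diag).trace = 0 := by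
      simp [trace, mul_diagonal, hV0]
    have : M = V + diagonal M.diag := by simp [hVdef]
    rw [hVh]
    conv_lhs => rw [this]
    rw [Matrix.mul_add, trace_add, hd, add_zero]
  have hVz : V = 0 := by
    rw [← trace_conjTranspose_mul_self_eq_zero_iff]
    have hp := posSemidef_conjTranspose_mul_self V
    rw [trace_eq_re hp, ← hVM]
    rw [hVM] at hle0 ⊢
    rw [le_antisymm hle0 (trace_re_nonneg hp), Complex.ofReal_zero]
  refine ⟨T, fun i => (M i i).re, hT, hTm.2.1, fun i => (Complex.lt_def.1 hMpd.diag_pos).1, ?_⟩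
  rw [hVdef, sub_eq_zero] at hVz
  refine hVz.trans (congrArg diagonal (funext fun i => ?_))
  exact Complex.ext rfl (by simpa using (Complex.lt_def.1 hMpd.diag_pos).2.symm)

/-- The left side is nonnegative when `l₁` is positive. Exchanging the two solutions reverses the
sign on the right, so both sides vanish; this is how uniqueness follows. Unit diagonals enter
through `Tr (T L) = ∑ l`. -/
theorem correlation_trace_identity {T₁ T₂ : Matrix (Fin n) (Fin n) ℂ} {l₁ l₂ : Fin n → ℝ}
    (h₂ : T₂.PosDef) (hd₁ : ∀ i, T₁ i i = 1) (hd₂ : ∀ i, T₂ i i = 1)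
    (h : T₁ * diagonal (fun i => (l₁ i : ℂ)) * T₁ = T₂ * diagonal (fun i => (l₂ i : ℂ)) * T₂) :
    ((T₂ - T₁) * diagonal (fun i => (l₁ i : ℂ)) * (T₂ - T₁) * T₂⁻¹).trace
      = ((∑ i, l₂ i - ∑ i, l₁ i : ℝ) : ℂ) := by
  have hu := posDef_isUnit_det h₂
  have ht : ∀ {T : Matrix (Fin n) (Fin n) ℂ} (l : Fin n → ℝ), (∀ i, T i i = 1) →
      (T * diagonal (fun i => (l i : ℂ))).trace = ((∑ i, l i : ℝ) : ℂ) := by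
    intro T l hT
    simp [trace, mul_diagonal, hT]
  set L := diagonal (fun i => (l₁ i : ℂ)) with hL
  have e : (T₂ - T₁) * L * (T₂ - T₁) * T₂⁻¹
      = T₂ * L - T₁ * L - T₂ * L * T₁ * T₂⁻¹ + T₁ * L * T₁ * T₂⁻¹ := by
    have : ∀ Y : Matrix (Fin n) (Fin n) ℂ, Y * T₂ * T₂⁻¹ = Y := fun Y => by
      rw [Matrix.mul_assoc, mul_nonsing_inv _ hu, Matrix.mul_one]
    simp only [Matrix.sub_mul, Matrix.mul_sub, this]
    abel
  have e2 : (T₂ * L * T₁ * T₂⁻¹).trace = (T₁ * L).trace := by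
    rw [trace_mul_comm, ← Matrix.mul_assoc, ← Matrix.mul_assoc, nonsing_inv_mul _ hu,
      Matrix.one_mul, trace_mul_comm]
  have e3 : (T₁ * L * T₁ * T₂⁻¹).trace = ((∑ i, l₂ i : ℝ) : ℂ) := by
    rw [h, Matrix.mul_assoc, mul_nonsing_inv _ hu, Matrix.mul_one, ht l₂ hd₂]
  rw [e, trace_add, trace_sub, trace_sub, e2, e3, ht l₁ hd₁, ht l₁ hd₂]
  push_cast
  ring

theorem correlation_unique {T₁ T₂ : Matrix (Fin n) (Fin n) ℂ} {l₁ l₂ : Fin n → ℝ}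
    (h₁ : T₁.PosDef) (h₂ : T₂.PosDef) (hd₁ : ∀ i, T₁ i i = 1) (hd₂ : ∀ i, T₂ i i = 1)
    (hl₁ : ∀ i, 0 < l₁ i) (hl₂ : ∀ i, 0 < l₂ i)
    (h : T₁ * diagonal (fun i => (l₁ i : ℂ)) * T₁ = T₂ * diagonal (fun i => (l₂ i : ℂ)) * T₂) :
    T₁ = T₂ ∧ l₁ = l₂ := by
  have hL : ∀ l : Fin n → ℝ, (∀ i, 0 < l i) → (diagonal (fun i => (l i : ℂ))).PosDef :=
    fun l hl => PosDef.diagonal fun i => by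
      rw [Complex.zero_lt_real]; exact hl i
  have hnn : ∀ {A B E : Matrix (Fin n) (Fin n) ℂ}, A.PosDef → B.PosDef → E.IsHermitian →
      0 ≤ (E * B * E * A).trace.re := by
    intro A B E hA hB hE
    refine trace_mul_re_nonneg ?_ hA.posSemidef
    have := hB.posSemidef.conjTranspose_mul_mul_same E
    rwa [hE] at this
  have i1 := correlation_trace_identity h₂ hd₁ hd₂ h
  have i2 := correlation_trace_identity h₁ hd₂ hd₁ h.symm
  have p1 := hnn h₂.inv (hL l₁ hl₁) (h₂.1.sub h₁.1)
  have p2 := hnn h₁.inv (hL l₂ hl₂) (h₁.1.sub h₂.1)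
  rw [i1, Complex.ofReal_re] at p1
  rw [i2, Complex.ofReal_re] at p2
  have hz := eq_zero_of_trace_eq_zero h₂.inv (hL l₁ hl₁) (h₂.1.sub h₁.1) (by
    rw [i1, Complex.ofReal_re]; linarith)
  have hT : T₁ = T₂ := (sub_eq_zero.1 hz).symm
  refine ⟨hT, ?_⟩
  subst hT
  have hu := h₁.isUnit
  have hdiag := hu.mul_left_cancel (hu.mul_right_cancel h)
  funext i
  have := congrFun (congrFun hdiag i) i
  simpa using this

end Correlation

/-! ### The matrix equation `X² = DGD` and the map `RGinv` -/

section MatrixSolution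

open Matrix

variable {n : ℕ}

theorem ofReal_re_diag {A : Matrix (Fin n) (Fin n) ℂ} (hA : A.PosDef) (i : Fin n) :
    ((A i i).re : ℂ) = A i i :=
  Complex.ext rfl (by simpa using (Complex.lt_def.1 hA.diag_pos).2)

theorem re_diag_pos {A : Matrix (Fin n) (Fin n) ℂ} (hA : A.PosDef) (i : Fin n) :
    0 < (A i i).re :=
  (Complex.lt_def.1 hA.diag_pos).1

theorem isUnit_diagonal {d : Fin n → ℝ} (hd : ∀ i, 0 < d i) :
    IsUnit (diagonal fun i => (d i : ℂ)) :=
  (PosDef.diagonal fun i => Complex.zero_lt_real.2 (hd i)).isUnit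

theorem posDef_diagonal_mul_mul_diagonal {A : Matrix (Fin n) (Fin n) ℂ} (hA : A.PosDef)
    {d : Fin n → ℝ} (hd : ∀ i, 0 < d i) :
    (diagonal (fun i => (d i : ℂ)) * A * diagonal fun i => (d i : ℂ)).PosDef := by
  have h := hA.conjTranspose_mul_mul_same (mulVec_injective_of_isUnit (isUnit_diagonal hd))
  have hD : (diagonal fun i => (d i : ℂ))ᴴ = diagonal fun i => (d i : ℂ) := by
    rw [diagonal_conjTranspose]
    congr 1
    ext i
    simp
  rwa [hD] at h

theorem smul_posDef {A : Matrix (Fin n) (Fin n) ℂ} (hA : A.PosDef) {r : ℝ} (hr : 0 < r) :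
    ((r : ℂ) • A).PosDef :=
  hA.smul (Complex.zero_lt_real.2 hr)

theorem diagonal_mul_inv_diagonal {d : Fin n → ℝ} (hd : ∀ i, 0 < d i) :
    diagonal (fun i => (d i : ℂ)) * diagonal (fun i => (((d i)⁻¹ : ℝ) : ℂ)) = 1 := by
  rw [diagonal_mul_diagonal, ← diagonal_one]
  congr 1
  ext i
  rw [← Complex.ofReal_mul, mul_inv_cancel₀ (hd i).ne', Complex.ofReal_one]

theorem inv_diagonal_mul_diagonal {d : Fin n → ℝ} (hd : ∀ i, 0 < d i) :
    diagonal (fun i => (((d i)⁻¹ : ℝ) : ℂ)) * diagonal (fun i => (d i : ℂ)) = 1 := by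
  rw [diagonal_mul_diagonal, ← diagonal_one]
  congr 1
  ext i
  rw [← Complex.ofReal_mul, inv_mul_cancel₀ (hd i).ne', Complex.ofReal_one]

namespace IsMatrixSolution

variable {G X : Matrix (Fin n) (Fin n) ℂ} {d : Fin n → ℝ}

theorem d_pos (h : IsMatrixSolution G X d) (hX : X.PosDef) (i : Fin n) : 0 < d i := by
  refine lt_of_le_of_ne (h.nonneg i) fun h0 => ?_
  have := hX.diag_pos (i := i)
  rw [h.diag i, ← h0] at this
  simp at this

theorem mul_self_apply (h : IsMatrixSolution G X d) (i j : Fin n) :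
    (X * X) i j = d i * G i j * d j := by
  rw [h.eq, mul_diagonal, diagonal_mul]

theorem exists_posDef (hG : G.PosDef) : ∃ X d, IsMatrixSolution G X d ∧ X.PosDef := by
  obtain ⟨T, l, hT, hd, hl, h⟩ := exists_correlation_diagonal hG
  have hu := posDef_isUnit_det hT
  have hs : ∀ i, 0 < √(l i) := fun i => Real.sqrt_pos.2 (hl i)
  have hpd := posDef_diagonal_mul_mul_diagonal hT hs
  refine ⟨_, fun i => √(l i), ⟨hpd.1, fun i => (hs i).le, fun i => ?_, ?_⟩, hpd⟩
  · rw [mul_diagonal, diagonal_mul, hd, mul_one, sq]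
  · have hL : diagonal (fun i => ((√(l i) : ℝ) : ℂ)) * diagonal (fun i => ((√(l i) : ℝ) : ℂ))
        = T⁻¹ * G * T⁻¹ := by
      rw [h, diagonal_mul_diagonal]
      congr 1
      ext i
      rw [← Complex.ofReal_mul, Real.mul_self_sqrt (hl i).le]
    set D := diagonal (fun i => ((√(l i) : ℝ) : ℂ))
    calc D * T * D * (D * T * D) = D * T * (D * D) * T * D := by simp only [Matrix.mul_assoc]
      _ = D * (T * T⁻¹) * G * (T⁻¹ * T) * D := by rw [hL]; simp only [Matrix.mul_assoc]
      _ = D * G * D := by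
        rw [mul_nonsing_inv _ hu, nonsing_inv_mul _ hu, Matrix.mul_one, Matrix.mul_one]

/-- The substitution `X = DTD` turns the equation into `T D² T = G`, to which the uniqueness for
correlation matrices applies. -/
theorem correlation_form (h : IsMatrixSolution G X d) (hX : X.PosDef) :
    let T := diagonal (fun i => (((d i)⁻¹ : ℝ) : ℂ)) * X * diagonal fun i => (((d i)⁻¹ : ℝ) : ℂ)
    T.PosDef ∧ (∀ i, T i i = 1) ∧ T * diagonal (fun i => ((d i ^ 2 : ℝ) : ℂ)) * T = G ∧
      diagonal (fun i => (d i : ℂ)) * T * diagonal (fun i => (d i : ℂ)) = X := by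
  have hd := h.d_pos hX
  have e1 := diagonal_mul_inv_diagonal hd
  have e2 := inv_diagonal_mul_diagonal hd
  refine ⟨posDef_diagonal_mul_mul_diagonal hX fun i => inv_pos.2 (hd i), fun i => ?_, ?_, ?_⟩
  · have : (d i : ℂ) ≠ 0 := by exact_mod_cast (hd i).ne'
    rw [mul_diagonal, diagonal_mul, h.diag]
    push_cast
    field_simp
  · have hsq : diagonal (fun i => ((d i ^ 2 : ℝ) : ℂ))
        = diagonal (fun i => (d i : ℂ)) * diagonal (fun i => (d i : ℂ)) := by
      rw [diagonal_mul_diagonal]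
      congr 1
      ext i
      push_cast
      ring
    rw [hsq]
    have hXX := h.eq
    set D := diagonal (fun i => (d i : ℂ))
    set D' := diagonal (fun i => (((d i)⁻¹ : ℝ) : ℂ))
    calc D' * X * D' * (D * D) * (D' * X * D')
        = D' * X * (D' * D) * (D * D') * X * D' := by simp only [Matrix.mul_assoc]
      _ = D' * (X * X) * D' := by rw [e1, e2]; simp only [Matrix.mul_assoc, Matrix.one_mul]
      _ = (D' * D) * G * (D * D') := by rw [hXX]; simp only [Matrix.mul_assoc]
      _ = G := by rw [e1, e2, Matrix.one_mul, Matrix.mul_one]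
  · set D := diagonal (fun i => (d i : ℂ))
    set D' := diagonal (fun i => (((d i)⁻¹ : ℝ) : ℂ))
    calc D * (D' * X * D') * D = (D * D') * X * (D' * D) := by simp only [Matrix.mul_assoc]
      _ = X := by rw [e1, e2, Matrix.one_mul, Matrix.mul_one]

theorem unique {X' : Matrix (Fin n) (Fin n) ℂ} {d' : Fin n → ℝ} (h : IsMatrixSolution G X d)
    (hX : X.PosDef) (h' : IsMatrixSolution G X' d') (hX' : X'.PosDef) : X = X' := by
  obtain ⟨a1, a2, a3, a4⟩ := h.correlation_form hX
  obtain ⟨b1, b2, b3, b4⟩ := h'.correlation_form hX'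
  obtain ⟨e1, e2⟩ := correlation_unique a1 b1 a2 b2 (fun i => pow_pos (h.d_pos hX i) 2)
    (fun i => pow_pos (h'.d_pos hX' i) 2) (a3.trans b3.symm)
  have hd : d = d' := by
    funext i
    exact (pow_left_inj₀ (h.nonneg i) (h'.nonneg i) two_ne_zero).1 (congrFun e2 i)
  rw [← a4, ← b4, e1, hd]

/-- The trace-one positive definite matrix proportional to `X²`. -/
theorem normalized_mem (h : IsMatrixSolution G X d) (hX : X.PosDef) (hG : G ∈ gramSet n) :
    0 < (X * X).trace.re ∧ ((((X * X).trace.re)⁻¹ : ℝ) : ℂ) • (X * X) ∈ gramSet n := by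
  have hXX : (X * X).PosDef := by
    rw [h.eq]
    exact posDef_diagonal_mul_mul_diagonal hG.1 (h.d_pos hX)
  have hne : Nonempty (Fin n) := by
    by_contra hcon
    rw [not_nonempty_iff] at hcon
    have := hG.2
    simp [trace] at this
  have hpos : 0 < (X * X).trace.re := (Complex.lt_def.1 hXX.trace_pos).1
  refine ⟨hpos, smul_posDef hXX (inv_pos.2 hpos), ?_⟩
  rw [trace_smul, trace_eq_re hXX.posSemidef, smul_eq_mul, Complex.ofReal_re,
    ← Complex.ofReal_mul, inv_mul_cancel₀ hpos.ne', Complex.ofReal_one]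

/-- Since `√Q = X / c`, both `q i` and `(√Q) i i` carry the factor `d i ^ 2`. It cancels in their
ratio `G i i / c`, and `Tr G = 1` then gives `normConst Q = c`. -/
theorem normalized_props (h : IsMatrixSolution G X d) (hX : X.PosDef) (hG : G ∈ gramSet n) :
    let c := √((X * X).trace.re)
    let Q := ((((X * X).trace.re)⁻¹ : ℝ) : ℂ) • (X * X)
    msqrt Q = ((c⁻¹ : ℝ) : ℂ) • X ∧ normConst Q = c ∧ RGinv Q = G := by
  intro c Q
  obtain ⟨hpos, -⟩ := h.normalized_mem hX hG
  have hc : 0 < c := Real.sqrt_pos.2 hpos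
  have hc2 : (X * X).trace.re = c ^ 2 := (Real.sq_sqrt hpos.le).symm
  have hd := h.d_pos hX
  have hg := re_diag_pos hG.1
  have hsq : msqrt Q = ((c⁻¹ : ℝ) : ℂ) • X := by
    refine msqrt_unique (smul_posSemidef hX.posSemidef (inv_nonneg.2 hc.le)) ?_
    rw [Matrix.smul_mul, Matrix.mul_smul, smul_smul, ← Complex.ofReal_mul]
    congr 2
    rw [hc2]
    field_simp
  have hQ : ∀ i j, Q i j = ((d i * d j / c ^ 2 : ℝ) : ℂ) * G i j := by
    intro i j
    have : Q i j = ((((X * X).trace.re)⁻¹ : ℝ) : ℂ) * (X * X) i j := rfl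
    rw [this, hc2, h.mul_self_apply]
    push_cast
    ring
  have hq : ∀ i, (Q i i).re = d i ^ 2 * (G i i).re / c ^ 2 := by
    intro i
    rw [hQ, Complex.re_ofReal_mul]
    ring
  have hs : ∀ i, (msqrt Q i i).re = d i ^ 2 / c := by
    intro i
    rw [hsq, Matrix.smul_apply, h.diag, smul_eq_mul, Complex.re_ofReal_mul, ← Complex.ofReal_pow,
      Complex.ofReal_re]
    ring
  have hr : ∀ i, (Q i i).re / (msqrt Q i i).re = (G i i).re / c := by
    intro i
    rw [hq, hs]
    have := (hd i).ne'
    field_simp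
  have hsum : ∑ i, (G i i).re = 1 := by
    have := congrArg Complex.re hG.2
    simpa [trace] using this
  have hn : normConst Q = c := by
    rw [normConst]
    simp only [hr]
    rw [← Finset.sum_div, hsum, one_div, inv_inv]
  have hp : ∀ i, priorOf Q i = (G i i).re := by
    intro i
    rw [priorOf, hn, hr]
    field_simp
  refine ⟨hsq, hn, ?_⟩
  ext i j
  have hsqrt : √((Q i i).re * (Q j j).re) = √((G i i).re * (G j j).re) * (d i * d j / c ^ 2) := by
    rw [hq, hq, show d i ^ 2 * (G i i).re / c ^ 2 * (d j ^ 2 * (G j j).re / c ^ 2)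
      = ((G i i).re * (G j j).re) * (d i * d j / c ^ 2) ^ 2 by ring,
      Real.sqrt_mul (mul_pos (hg i) (hg j)).le, Real.sqrt_sq]
    have := hd i
    have := hd j
    positivity
  rw [RGinv, of_apply, hp, hp, hsqrt, hQ]
  have h1 : ((√((G i i).re * (G j j).re) : ℝ) : ℂ) ≠ 0 := by
    exact_mod_cast (Real.sqrt_pos.2 (mul_pos (hg i) (hg j))).ne'
  have h2 : ((d i * d j / c ^ 2 : ℝ) : ℂ) ≠ 0 := by
    have := hd i
    have := hd j
    exact_mod_cast (show 0 < d i * d j / c ^ 2 by positivity).ne'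
  rw [Complex.ofReal_mul]
  field_simp

end IsMatrixSolution

theorem sum_div_msqrt_pos {Q : Matrix (Fin n) (Fin n) ℂ} (hQ : Q ∈ gramSet n) :
    0 < ∑ j, (Q j j).re / (msqrt Q j j).re := by
  have hne : Nonempty (Fin n) := by
    by_contra hcon
    rw [not_nonempty_iff] at hcon
    have := hQ.2
    simp [trace] at this
  exact Finset.sum_pos (fun j _ => div_pos (re_diag_pos hQ.1 j)
    (re_diag_pos (msqrt_posDef hQ.1) j)) Finset.univ_nonempty

theorem normConst_pos {Q : Matrix (Fin n) (Fin n) ℂ} (hQ : Q ∈ gramSet n) : 0 < normConst Q :=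
  inv_pos.2 (sum_div_msqrt_pos hQ)

/-- Changing the priors is a diagonal congruence; the square of its entry is `p i / q i = C / (√Q) i
i`. -/
theorem RGinv_eq {Q : Matrix (Fin n) (Fin n) ℂ} (hQ : Q ∈ gramSet n) :
    RGinv Q = diagonal (fun i => ((√(normConst Q / (msqrt Q i i).re) : ℝ) : ℂ)) * Q *
      diagonal (fun i => ((√(normConst Q / (msqrt Q i i).re) : ℝ) : ℂ)) := by
  have hC := normConst_pos hQ
  have hs := re_diag_pos (msqrt_posDef hQ.1)
  have hq := re_diag_pos hQ.1
  ext i j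
  rw [mul_diagonal, diagonal_mul, RGinv, of_apply, priorOf, priorOf]
  have e : √(normConst Q * ((Q i i).re / (msqrt Q i i).re) *
        (normConst Q * ((Q j j).re / (msqrt Q j j).re)))
      = √(normConst Q / (msqrt Q i i).re) * √(normConst Q / (msqrt Q j j).re) *
        √((Q i i).re * (Q j j).re) := by
    rw [← Real.sqrt_mul (div_pos hC (hs i)).le, ← Real.sqrt_mul
      (mul_pos (div_pos hC (hs i)) (div_pos hC (hs j))).le]
    congr 1
    ring
  have h1 : ((√((Q i i).re * (Q j j).re) : ℝ) : ℂ) ≠ 0 := by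
    exact_mod_cast (Real.sqrt_pos.2 (mul_pos (hq i) (hq j))).ne'
  rw [e]
  push_cast
  field_simp

theorem RGinv_mem {Q : Matrix (Fin n) (Fin n) ℂ} (hQ : Q ∈ gramSet n) : RGinv Q ∈ gramSet n := by
  have hC := normConst_pos hQ
  have hs := re_diag_pos (msqrt_posDef hQ.1)
  have hq := re_diag_pos hQ.1
  constructor
  · rw [RGinv_eq hQ]
    exact posDef_diagonal_mul_mul_diagonal hQ.1 fun i => Real.sqrt_pos.2 (div_pos hC (hs i))
  · have hii : ∀ i, RGinv Q i i = (priorOf Q i : ℂ) := by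
      intro i
      have hp : 0 ≤ priorOf Q i := (mul_pos hC (div_pos (hq i) (hs i))).le
      have h1 : ((Q i i).re : ℂ) ≠ 0 := by exact_mod_cast (hq i).ne'
      rw [RGinv, of_apply, Real.sqrt_mul_self hp, Real.sqrt_mul_self (hq i).le]
      rw [ofReal_re_diag hQ.1] at h1 ⊢
      rw [div_self h1, mul_one]
    simp only [trace, diag_apply, hii]
    rw [← Complex.ofReal_sum]
    simp only [priorOf]
    rw [← Finset.mul_sum, normConst, inv_mul_cancel₀ (sum_div_msqrt_pos hQ).ne',
      Complex.ofReal_one]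

/-- The chosen `D` is `C` times the inverse of the diagonal congruence defining `RGinv Q`, so `D
(RGinv Q) D = C² Q = (C √Q)²`. -/
theorem isMatrixSolution_RGinv {Q : Matrix (Fin n) (Fin n) ℂ} (hQ : Q ∈ gramSet n) :
    IsMatrixSolution (RGinv Q) ((normConst Q : ℂ) • msqrt Q)
      (fun i => √(normConst Q * (msqrt Q i i).re)) := by
  have hC := normConst_pos hQ
  have hS := msqrt_posDef hQ.1
  have hs := re_diag_pos hS
  refine ⟨(smul_posDef hS hC).1, fun i => Real.sqrt_nonneg _, fun i => ?_, ?_⟩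
  · rw [← Complex.ofReal_pow, Real.sq_sqrt (mul_pos hC (hs i)).le, Complex.ofReal_mul,
      ofReal_re_diag hS]
    rfl
  · have hDE : diagonal (fun i => ((√(normConst Q * (msqrt Q i i).re) : ℝ) : ℂ)) *
        diagonal (fun i => ((√(normConst Q / (msqrt Q i i).re) : ℝ) : ℂ))
        = (normConst Q : ℂ) • 1 := by
      rw [diagonal_mul_diagonal, ← diagonal_one, ← diagonal_smul]
      congr 1
      ext i
      rw [← Complex.ofReal_mul, ← Real.sqrt_mul (mul_pos hC (hs i)).le,
        show normConst Q * (msqrt Q i i).re * (normConst Q / (msqrt Q i i).re)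
          = normConst Q ^ 2 by have := (hs i).ne'; field_simp, Real.sqrt_sq hC.le]
      simp
    have hcomm := (commute_diagonal (fun i => ((√(normConst Q * (msqrt Q i i).re) : ℝ) : ℂ))
      (fun i => ((√(normConst Q / (msqrt Q i i).re) : ℝ) : ℂ))).eq
    rw [RGinv_eq hQ]
    set D := diagonal (fun i => ((√(normConst Q * (msqrt Q i i).re) : ℝ) : ℂ))
    set E := diagonal (fun i => ((√(normConst Q / (msqrt Q i i).re) : ℝ) : ℂ))
    have e : D * (E * Q * E) * D = (D * E) * Q * (E * D) := by simp only [Matrix.mul_assoc]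
    rw [e, ← hcomm, hDE]
    simp only [Matrix.smul_mul, Matrix.mul_smul, Matrix.one_mul, Matrix.mul_one,
      msqrt_mul_self hQ.1.posSemidef]

theorem bijOn_RGinv : Set.BijOn (RGinv (n := n)) (gramSet n) (gramSet n) := by
  refine ⟨fun Q hQ => RGinv_mem hQ, fun Q₁ h₁ Q₂ h₂ h => ?_, fun G hG => ?_⟩
  · have a := isMatrixSolution_RGinv h₁
    have b := isMatrixSolution_RGinv h₂
    have hX := smul_posDef (msqrt_posDef h₁.1) (normConst_pos h₁)
    have hY := smul_posDef (msqrt_posDef h₂.1) (normConst_pos h₂)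
    rw [h] at a
    have e := a.unique hX b hY
    -- As `Tr Q = 1`, normalising `X²` recovers `Q` without knowing `C`.
    have key : ∀ {Q : Matrix (Fin n) (Fin n) ℂ}, Q ∈ gramSet n → ∀ X : Matrix (Fin n) (Fin n) ℂ,
        X = (normConst Q : ℂ) • msqrt Q → Q = (X * X).trace⁻¹ • (X * X) := by
      rintro Q hQ X rfl
      have hC : (normConst Q : ℂ) ≠ 0 := by exact_mod_cast (normConst_pos hQ).ne'
      rw [Matrix.smul_mul, Matrix.mul_smul, msqrt_mul_self hQ.1.posSemidef,
        smul_smul (normConst Q : ℂ), trace_smul, hQ.2, smul_smul, smul_eq_mul, mul_one, inv_mul_cancel₀ (mul_ne_zero hC hC), one_smul]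
    exact (key h₁ _ rfl).trans (key h₂ _ e).symm
  · obtain ⟨X, d, h, hX⟩ := IsMatrixSolution.exists_posDef hG.1
    exact ⟨_, (h.normalized_mem hX hG).2, (h.normalized_props hX hG).2.2⟩

theorem IsMatrixSolution.RG_eq {G X : Matrix (Fin n) (Fin n) ℂ} {d : Fin n → ℝ}
    (h : IsMatrixSolution G X d) (hX : X.PosDef) (hG : G ∈ gramSet n) :
    RG G = ((((X * X).trace.re)⁻¹ : ℝ) : ℂ) • (X * X) := by
  conv_lhs => rw [← (h.normalized_props hX hG).2.2]
  exact bijOn_RGinv.injOn.leftInvOn_invFunOn (h.normalized_mem hX hG).2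

theorem IsMatrixSolution.RG_eq_diagonal {G X : Matrix (Fin n) (Fin n) ℂ} {d : Fin n → ℝ}
    (h : IsMatrixSolution G X d) (hX : X.PosDef) (hG : G ∈ gramSet n) :
    RG G = ((diagonal (fun i => (d i : ℂ)) ^ 2 * G).trace)⁻¹ •
      (diagonal (fun i => (d i : ℂ)) * G * diagonal (fun i => (d i : ℂ))) := by
  have hp : (X * X).PosSemidef := by
    have := posSemidef_conjTranspose_mul_self X
    rwa [hX.1] at this
  have ht : (diagonal (fun i => (d i : ℂ)) ^ 2 * G).trace = (X * X).trace := by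
    rw [h.eq, trace_mul_comm _ (diagonal _), ← Matrix.mul_assoc, sq]
  rw [h.RG_eq hX hG, ht, ← h.eq, trace_eq_re hp, Complex.ofReal_re, Complex.ofReal_inv]

end MatrixSolution

/-! ### Duality bound and its equality case -/

section Bound

open Matrix

variable {n : ℕ}

/-- Dual feasibility of `X`. With `S = √X`, the vector `S eᵢ` has squared norm `X i i = d i ^ 2`, so
`Q` is the orthogonal projection onto it and the difference is `S (1 - Q) S`. -/
theorem posSemidef_sub_of_diag {X : Matrix (Fin n) (Fin n) ℂ} (hX : X.PosDef) {d : Fin n → ℝ}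
    (hd : ∀ i, 0 < d i) (hdiag : ∀ i, X i i = (d i : ℂ) ^ 2) (i : Fin n) :
    (X - ((d i : ℂ) ^ 2)⁻¹ • (X * single i i 1 * X)).PosSemidef := by
  set S := msqrt X with hS
  have hSh : Sᴴ = S := (msqrt_posSemidef X).1
  have hSS : S * S = X := msqrt_mul_self hX.posSemidef
  have hdi : (d i : ℂ) ≠ 0 := by exact_mod_cast (hd i).ne'
  set Q := ((d i : ℂ) ^ 2)⁻¹ • (S * single i i 1 * S) with hQ
  have hQh : Qᴴ = Q := by
    rw [hQ, conjTranspose_smul, conjTranspose_mul, conjTranspose_mul, hSh, conjTranspose_single,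
      Matrix.mul_assoc]
    simp
  have hmid : single i i (1 : ℂ) * X * single i i 1 = (d i : ℂ) ^ 2 • single i i 1 := by
    rw [single_mul_mul_single, hdiag, smul_single]
    simp
  have hQQ : Q * Q = Q := by
    rw [hQ, Matrix.smul_mul, Matrix.mul_smul, smul_smul]
    have : S * single i i (1 : ℂ) * S * (S * single i i 1 * S)
        = S * (single i i 1 * (S * S) * single i i 1) * S := by simp only [Matrix.mul_assoc]
    rw [this, hSS, hmid, Matrix.mul_smul, Matrix.smul_mul, smul_smul]
    congr 1
    field_simp
  have h1 : (1 - Q).PosSemidef := by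
    have := posSemidef_conjTranspose_mul_self (1 - Q)
    rw [conjTranspose_sub, hQh, conjTranspose_one, Matrix.mul_sub, Matrix.sub_mul _ _ Q, hQQ] at this
    simpa using this
  have h2 := h1.conjTranspose_mul_mul_same S
  convert h2 using 1
  rw [hSh, Matrix.mul_sub, Matrix.sub_mul, Matrix.mul_one, hSS, hQ, Matrix.mul_smul,
    Matrix.smul_mul]
  congr 2
  rw [← hSS]
  simp only [Matrix.mul_assoc]

variable {X : Matrix (Fin n) (Fin n) ℂ} {d : Fin n → ℝ} {A : Fin n → Matrix (Fin n) (Fin n) ℂ}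

/-- The duality gap, as a sum of traces of products that are nonnegative when the `A i` form a POVM.
-/
theorem sum_trace_gap (hsum : ∑ i, A i = 1) :
    ∑ i, (A i * (X - ((d i : ℂ) ^ 2)⁻¹ • (X * single i i 1 * X))).trace.re
      = X.trace.re - ∑ i, ((X * A i * X) i i).re / d i ^ 2 := by
  have h1 : ∀ i, (A i * (X - ((d i : ℂ) ^ 2)⁻¹ • (X * single i i 1 * X))).trace.re
      = (A i * X).trace.re - ((X * A i * X) i i).re / d i ^ 2 := by
    intro i
    have e : (A i * (X * single i i (1 : ℂ) * X)).trace = (X * A i * X) i i := by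
      rw [← Matrix.mul_assoc, trace_mul_comm, ← Matrix.mul_assoc, ← Matrix.mul_assoc,
        trace_mul_single]
      simp
    rw [Matrix.mul_sub, trace_sub, Matrix.mul_smul, trace_smul, e, smul_eq_mul, Complex.sub_re,
      ← Complex.ofReal_pow, ← Complex.ofReal_inv, Complex.re_ofReal_mul, inv_mul_eq_div]
  simp only [h1, Finset.sum_sub_distrib]
  rw [← Complex.re_sum, ← trace_sum, ← Finset.sum_mul, hsum, Matrix.one_mul]

theorem sum_div_le_trace (hX : X.PosDef) (hd : ∀ i, 0 < d i)
    (hdiag : ∀ i, X i i = (d i : ℂ) ^ 2) (hA : ∀ i, (A i).PosSemidef) (hsum : ∑ i, A i = 1) :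
    ∑ i, ((X * A i * X) i i).re / d i ^ 2 ≤ X.trace.re := by
  rw [← sub_nonneg, ← sum_trace_gap hsum]
  exact Finset.sum_nonneg fun i _ =>
    trace_mul_re_nonneg (hA i) (posSemidef_sub_of_diag hX hd hdiag i)

theorem eq_single_of_sum_div_eq_trace (hX : X.PosDef) (hd : ∀ i, 0 < d i)
    (hdiag : ∀ i, X i i = (d i : ℂ) ^ 2) (hA : ∀ i, (A i).PosSemidef) (hsum : ∑ i, A i = 1)
    (h : ∑ i, ((X * A i * X) i i).re / d i ^ 2 = X.trace.re) (i : Fin n) :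
    A i = single i i 1 := by
  have hK := posSemidef_sub_of_diag hX hd hdiag
  have h0 : ∀ i, (A i * (X - ((d i : ℂ) ^ 2)⁻¹ • (X * single i i 1 * X))).trace.re = 0 := by
    have := sum_trace_gap (X := X) (d := d) hsum
    rw [h, sub_self, Finset.sum_eq_zero_iff_of_nonneg
      fun i _ => trace_mul_re_nonneg (hA i) (hK i)] at this
    exact fun i => this i (Finset.mem_univ i)
  -- A zero gap makes every product vanish; cancelling `X` on the right leaves `A i` supported on
  -- column `i`, hence by Hermiticity on the entry `(i, i)`.
  have h1 : ∀ i, A i = (((d i : ℂ) ^ 2)⁻¹ • (A i * X)) * single i i 1 := by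
    intro i
    have := mul_eq_zero_of_trace_mul_eq_zero (hA i) (hK i) (h0 i)
    rw [Matrix.mul_sub, sub_eq_zero, Matrix.mul_smul, ← Matrix.mul_assoc, ← Matrix.mul_assoc,
      ← Matrix.smul_mul, ← Matrix.smul_mul] at this
    exact hX.isUnit.mul_right_cancel this
  have hcol : ∀ i k l, l ≠ i → A i k l = 0 := by
    intro i k l hl
    rw [h1 i]
    exact mul_single_apply_of_ne _ _ _ _ _ hl _
  have hrow : ∀ i k l, k ≠ i → A i k l = 0 := by
    intro i k l hk
    rw [← (hA i).1.apply k l, hcol i l k hk, star_zero]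
  have hii : A i i i = 1 := by
    have := congrFun (congrFun hsum i) i
    rw [one_apply_eq, Matrix.sum_apply, Finset.sum_eq_single i] at this
    · exact this
    · exact fun j _ hj => hcol j i i hj.symm
    · simp
  ext k l
  by_cases hk : k = i
  · by_cases hl : l = i
    · subst hk hl
      simpa using hii
    · rw [hcol i k l hl, single_apply_of_ne]
      exact fun hc => hl hc.2.symm
  · rw [hrow i k l hk, single_apply_of_ne]
    exact fun hc => hk hc.1.symm

end Bound

/-! ### Matrices of operators in an orthonormal basis -/

section Operator

open Matrix

variable {n : ℕ} {H : Type*} [NormedAddCommGroup H] [InnerProductSpace ℂ H]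

/-- The matrix of an operator in an orthonormal basis. -/
def opMatrix (w : OrthonormalBasis (Fin n) ℂ H) (F : H →L[ℂ] H) : Matrix (Fin n) (Fin n) ℂ :=
  of fun k l => inner ℂ (w k) (F (w l))

variable (w : OrthonormalBasis (Fin n) ℂ H)

theorem inner_apply_eq_sum (F : H →L[ℂ] H) (u v : H) :
    inner ℂ u (F v) = ∑ k, ∑ l, inner ℂ u (w k) * opMatrix w F k l * inner ℂ (w l) v := by
  conv_lhs => rw [← w.sum_repr' v, ← w.sum_inner_mul_inner u]
  refine Finset.sum_congr rfl fun k _ => ?_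
  rw [map_sum, inner_sum, Finset.mul_sum]
  refine Finset.sum_congr rfl fun l _ => ?_
  rw [map_smul, inner_smul_right, opMatrix, of_apply]
  ring

theorem opMatrix_injective {F F' : H →L[ℂ] H} (h : opMatrix w F = opMatrix w F') : F = F' := by
  refine ContinuousLinearMap.ext fun v => ext_inner_left ℂ fun u => ?_
  rw [inner_apply_eq_sum w, inner_apply_eq_sum w, h]

theorem opMatrix_posSemidef {F : H →L[ℂ] H} (hF : F.IsPositive) :
    (opMatrix w F).PosSemidef := by
  refine PosSemidef.of_dotProduct_mulVec_nonneg ?_ fun x => ?_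
  · ext k l
    rw [conjTranspose_apply, opMatrix, of_apply, of_apply, RCLike.star_def, inner_conj_symm]
    exact hF.isSymmetric _ _
  · have hx : ∀ k, inner ℂ (w k) (∑ l, x l • w l) = x k := fun k =>
      w.orthonormal.inner_right_fintype x k
    have h := (hF.inner_nonneg_right (∑ l, x l • w l))
    rw [inner_apply_eq_sum w] at h
    convert h using 1
    simp only [dotProduct, mulVec, Finset.mul_sum, hx, Pi.star_apply]
    refine Finset.sum_congr rfl fun k _ => Finset.sum_congr rfl fun l _ => ?_
    rw [← inner_conj_symm (∑ l, x l • w l), hx, RCLike.star_def]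
    ring

theorem opMatrix_one : opMatrix w (1 : H →L[ℂ] H) = 1 := by
  ext k l
  rw [opMatrix, of_apply, one_apply_eq_self, one_apply,
    orthonormal_iff_ite.1 w.orthonormal]

theorem opMatrix_sum (F : Fin n → H →L[ℂ] H) :
    opMatrix w (∑ i, F i) = ∑ i, opMatrix w (F i) := by
  ext k l
  simp [opMatrix, Matrix.sum_apply]

theorem opMatrix_proj (i : Fin n) : opMatrix w (proj w i) = single i i 1 := by
  ext k l
  rw [opMatrix, of_apply, proj, ketbra, InnerProductSpace.rankOne_apply, inner_smul_right,
    orthonormal_iff_ite.1 w.orthonormal, orthonormal_iff_ite.1 w.orthonormal, single_apply]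
  by_cases hk : k = i <;> by_cases hl : i = l <;> simp [hk, hl, eq_comm]

theorem isPOVM_proj : IsPOVM (proj w) :=
  ⟨fun _ => InnerProductSpace.isPositive_rankOne_self _, w.sum_rankOne_eq_id⟩

end Operator

/-! ### Rank-one projective solutions and optimality -/

section EnsembleTheory

open Matrix

variable {n : ℕ} {H : Type*} [NormedAddCommGroup H] [InnerProductSpace ℂ H]

namespace Ensemble

variable (P : Ensemble n H)

theorem sqrt_mul_sqrt (i : Fin n) : ((√(P.p i) : ℝ) : ℂ) * ((√(P.p i) : ℝ) : ℂ) = (P.p i : ℂ) := by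
  rw [← Complex.ofReal_mul, Real.mul_self_sqrt (P.p_pos i).le]

theorem ketbra_tilde (i : Fin n) : ketbra (P.tilde i) = (P.p i : ℂ) • ketbra (P.ψ i) := by
  ext v
  simp only [ketbra, tilde, InnerProductSpace.rankOne_apply, _root_.smul_apply,
    inner_smul_left, smul_smul, Complex.conj_ofReal]
  rw [← P.sqrt_mul_sqrt i]
  congr 1
  ring

theorem inner_tilde_apply (F : H →L[ℂ] H) (i : Fin n) :
    inner ℂ (P.tilde i) (F (P.tilde i)) = (P.p i : ℂ) * inner ℂ (P.ψ i) (F (P.ψ i)) := by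
  rw [tilde, map_smul, inner_smul_left, inner_smul_right, Complex.conj_ofReal, ← mul_assoc,
    P.sqrt_mul_sqrt]

theorem gram_apply_self (i : Fin n) : P.gram i i = (P.p i : ℂ) := by
  have h := P.inner_tilde_apply 1 i
  simp only [one_apply_eq_self] at h
  rw [inner_self_eq_norm_sq_to_K, inner_self_eq_norm_sq_to_K, P.norm_ψ] at h
  rw [gram, Matrix.gram_apply, inner_self_eq_norm_sq_to_K, h]
  simp

theorem gram_mem : P.gram ∈ gramSet n := by
  refine ⟨P.gram_posDef, ?_⟩
  simp only [trace, diag_apply, gram_apply_self]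
  rw [← Complex.ofReal_sum, P.p_sum, Complex.ofReal_one]

theorem inner_tilde_sum_u (M : Matrix (Fin n) (Fin n) ℂ) (k i : Fin n) :
    inner ℂ (P.tilde k) (∑ j, M j i • P.u j) = M k i := by
  simp [P.inner_tilde_u]

theorem inner_u_u (j k : Fin n) : inner ℂ (P.u j) (P.u k) = P.gram⁻¹ j k := by
  conv_lhs => rw [u]
  simp only [sum_inner, inner_smul_left, P.inner_tilde_u]
  simp only [mul_ite, mul_one, mul_zero, Finset.sum_ite_eq', Finset.mem_univ, if_true]
  exact P.gram_posDef.inv.1.apply j k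

theorem inner_sum_u_sum_u (M : Matrix (Fin n) (Fin n) ℂ) (i k : Fin n) :
    inner ℂ (∑ j, M j i • P.u j) (∑ j, M j k • P.u j) = (Mᴴ * P.gram⁻¹ * M) i k := by
  simp only [sum_inner, inner_sum, inner_smul_left, inner_smul_right, P.inner_u_u, mul_apply,
    conjTranspose_apply, Finset.sum_mul, Finset.mul_sum, RCLike.star_def]
  refine Finset.sum_congr rfl fun k _ => Finset.sum_congr rfl fun l _ => ?_
  ring

theorem finrank_eq (P : Ensemble n H) : Module.finrank ℂ H = n := by
  rw [Module.finrank_eq_card_basis (Module.Basis.mk P.indep P.span_top.ge), Fintype.card_fin]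

/-- The slackness conditions of a rank-one projective measurement in terms of the overlaps
`⟨√(p k) ψ k|w i⟩`. -/
theorem slack_proj_iff (w : OrthonormalBasis (Fin n) ℂ H) :
    P.Slack (proj w) ↔ ∀ i j,
      inner ℂ (w j) (P.tilde j) * inner ℂ (P.tilde j) (w i)
        = inner ℂ (w j) (P.tilde i) * inner ℂ (P.tilde i) (w i) := by
  refine forall_congr' fun i => forall_congr' fun j => ?_
  have key : ∀ v, (proj w j * ((P.p j : ℂ) • ketbra (P.ψ j) - (P.p i : ℂ) • ketbra (P.ψ i)) *
      proj w i) v = (inner ℂ (w i) v * (inner ℂ (w j) (P.tilde j) * inner ℂ (P.tilde j) (w i)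
        - inner ℂ (w j) (P.tilde i) * inner ℂ (P.tilde i) (w i))) • w j := by
    intro v
    rw [← P.ketbra_tilde, ← P.ketbra_tilde]
    change proj w j ((ketbra (P.tilde j) - ketbra (P.tilde i)) (proj w i v)) = _
    simp only [proj, ketbra, _root_.sub_apply, InnerProductSpace.rankOne_apply, map_smul, inner_sub_right, inner_smul_right, smul_smul]
    congr 1
    ring
  constructor
  · intro h
    have h1 := key (w i)
    rw [h, _root_.zero_apply, eq_comm, smul_eq_zero] at h1
    rcases h1 with h1 | h1
    · rw [inner_self_eq_norm_sq_to_K, w.orthonormal.1 i] at h1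
      simpa [sub_eq_zero] using h1
    · exact absurd h1 (w.orthonormal.ne_zero j)
  · intro h
    ext v
    rw [key, h, sub_self, mul_zero, zero_smul, _root_.zero_apply]

namespace IsProjSolution

variable {P} {w : OrthonormalBasis (Fin n) ℂ H} {W : Matrix (Fin n) (Fin n) ℂ}

theorem inner_tilde (h : P.IsProjSolution w W) (k i : Fin n) :
    inner ℂ (P.tilde k) (w i) = (msqrt P.gram * W) k i := by
  rw [h.repr, P.inner_tilde_sum_u]

theorem diag_eq (h : P.IsProjSolution w W) (i : Fin n) :
    (msqrt P.gram * W) i i = (((msqrt P.gram * W) i i).re : ℂ) :=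
  Complex.ext rfl (by simpa using h.diag_im i)

theorem D_eq (h : P.IsProjSolution w W) :
    P.D W = diagonal fun i => (((msqrt P.gram * W) i i).re : ℂ) :=
  congrArg diagonal (funext h.diag_eq)

theorem X_apply (h : P.IsProjSolution w W) (i j : Fin n) :
    P.X W i j = (((msqrt P.gram * W) i i).re : ℂ) * (msqrt P.gram * W) i j := by
  rw [Ensemble.X, Matrix.mul_assoc, h.D_eq, diagonal_mul]

theorem isMatrixSolution (h : P.IsProjSolution w W) :
    IsMatrixSolution P.gram (P.X W) (fun i => ((msqrt P.gram * W) i i).re) := by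
  have hX : (P.X W).IsHermitian := by
    ext i j
    have hs := (P.slack_proj_iff w).1 h.slack j i
    simp only [← inner_conj_symm (w _) (P.tilde _), h.inner_tilde] at hs
    rw [h.diag_eq i, h.diag_eq j, Complex.conj_ofReal] at hs
    rw [conjTranspose_apply, h.X_apply, h.X_apply, RCLike.star_def, map_mul, Complex.conj_ofReal,
      hs, mul_comm]
  refine ⟨hX, h.diag_re, fun i => ?_, ?_⟩
  · rw [h.X_apply, sq, ← h.diag_eq]
  · have hDh : (P.D W)ᴴ = P.D W := by
      rw [h.D_eq, diagonal_conjTranspose]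
      congr 1
      ext i
      simp
    have hWW : W * Wᴴ = 1 := (Matrix.mem_unitaryGroup_iff).1 h.unitary
    rw [← h.D_eq]
    -- Hermiticity, which is the content of the slackness conditions, allows `X²` to be computed as
    -- `X Xᴴ`, where `W` cancels.
    nth_rewrite 2 [← hX]
    rw [Ensemble.X, conjTranspose_mul, conjTranspose_mul, hDh, (msqrt_posSemidef _).1]
    calc P.D W * msqrt P.gram * W * (Wᴴ * (msqrt P.gram * P.D W))
        = P.D W * msqrt P.gram * (W * Wᴴ) * msqrt P.gram * P.D W := by
          simp only [Matrix.mul_assoc]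
      _ = P.D W * (msqrt P.gram * msqrt P.gram) * P.D W := by
          rw [hWW, Matrix.mul_one]; simp only [Matrix.mul_assoc]
      _ = P.D W * P.gram * P.D W := by rw [msqrt_mul_self P.gram_posDef.posSemidef]

theorem d_pos (h : P.IsProjSolution w W) (hX : (P.X W).PosDef) (i : Fin n) :
    0 < ((msqrt P.gram * W) i i).re :=
  h.isMatrixSolution.d_pos hX i

/-- The overlaps are `⟨√(p i) ψ i|w k⟩ = X i k / d i`, which puts the success probability in the
form of the duality bound. -/
theorem successProb_eq (h : P.IsProjSolution w W) (hX : (P.X W).PosDef)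
    (F : Fin n → H →L[ℂ] H) :
    P.successProb F = ∑ i, ((P.X W * opMatrix w (F i) * P.X W) i i).re /
      ((msqrt P.gram * W) i i).re ^ 2 := by
  refine Finset.sum_congr rfl fun i _ => ?_
  have hd := h.d_pos hX i
  set r := ((msqrt P.gram * W) i i).re with hr
  have hM : ∀ k, inner ℂ (P.tilde i) (w k) = ((r⁻¹ : ℝ) : ℂ) * P.X W i k := by
    intro k
    have : (r : ℂ) ≠ 0 := by exact_mod_cast hd.ne'
    rw [h.inner_tilde, h.X_apply, ← hr]
    push_cast
    field_simp
  have hM' : ∀ k, inner ℂ (w k) (P.tilde i) = ((r⁻¹ : ℝ) : ℂ) * P.X W k i := by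
    intro k
    rw [← inner_conj_symm, hM, map_mul, Complex.conj_ofReal, ← hX.1.apply k i]
    rfl
  rw [← Complex.re_ofReal_mul, ← P.inner_tilde_apply, inner_apply_eq_sum w, div_eq_inv_mul,
    ← Complex.re_ofReal_mul]
  congr 1
  simp only [hM, hM', mul_apply, Finset.sum_mul, Finset.mul_sum]
  rw [Finset.sum_comm]
  refine Finset.sum_congr rfl fun k _ => Finset.sum_congr rfl fun l _ => ?_
  push_cast
  ring

theorem successProb_proj (h : P.IsProjSolution w W) (hX : (P.X W).PosDef) :
    P.successProb (proj w) = (P.X W).trace.re := by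
  rw [h.successProb_eq hX, trace, Complex.re_sum]
  refine Finset.sum_congr rfl fun i _ => ?_
  have hd := h.d_pos hX i
  have e : (P.X W * single i i (1 : ℂ) * P.X W) i i = P.X W i i * P.X W i i := by
    rw [mul_apply, Finset.sum_eq_single i]
    · simp
    · intro j _ hj
      rw [mul_single_apply_of_ne _ _ _ _ _ hj, zero_mul]
    · simp
  rw [opMatrix_proj, e, diag_apply, h.isMatrixSolution.diag i, ← Complex.ofReal_pow,
    ← Complex.ofReal_mul, Complex.ofReal_re, Complex.ofReal_re]
  field_simp

theorem isOptimal_of_posDef (h : P.IsProjSolution w W) (hX : (P.X W).PosDef) :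
    P.IsOptimal (proj w) := by
  refine ⟨isPOVM_proj w, fun F hF => ?_⟩
  rw [h.successProb_proj hX, h.successProb_eq hX]
  refine sum_div_le_trace hX (h.d_pos hX) h.isMatrixSolution.diag
    (fun i => opMatrix_posSemidef w (hF.1 i)) ?_
  rw [← opMatrix_sum, hF.2, opMatrix_one]

theorem eq_proj_of_isOptimal (h : P.IsProjSolution w W) (hX : (P.X W).PosDef)
    {E : Fin n → H →L[ℂ] H} (hE : P.IsOptimal E) : E = proj w := by
  funext i
  refine opMatrix_injective w ?_
  rw [opMatrix_proj]
  refine eq_single_of_sum_div_eq_trace (A := fun i => opMatrix w (E i)) hX (h.d_pos hX)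
    h.isMatrixSolution.diag (fun i => opMatrix_posSemidef w (hE.1.1 i)) ?_ ?_ i
  · rw [← opMatrix_sum, hE.1.2, opMatrix_one]
  · rw [← h.successProb_eq hX, ← h.successProb_proj hX]
    exact le_antisymm ((h.isOptimal_of_posDef hX).2 E hE.1) (hE.2 _ (isPOVM_proj w))

end IsProjSolution

/-- `M = D⁻¹X` satisfies `M Mᴴ = G`, so `M = √G W` with `W` unitary. Because the `u j` have Gram
matrix `G⁻¹`, the columns of `M` give an orthonormal basis. The diagonal of `M` is `d`, and
slackness is the Hermiticity of `DM = X`. -/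
theorem exists_isProjSolution {X : Matrix (Fin n) (Fin n) ℂ} {d : Fin n → ℝ}
    (h : IsMatrixSolution P.gram X d) (hX : X.PosDef) :
    ∃ w W, P.IsProjSolution w W ∧ P.X W = X := by
  have hd := h.d_pos hX
  set D := diagonal (fun i => (d i : ℂ)) with hD
  set D' := diagonal (fun i => (((d i)⁻¹ : ℝ) : ℂ)) with hD'
  have e1 : D * D' = 1 := diagonal_mul_inv_diagonal hd
  have e2 : D' * D = 1 := inv_diagonal_mul_diagonal hd
  have hD'h : D'ᴴ = D' := by
    rw [hD', diagonal_conjTranspose]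
    congr 1
    ext i
    simp
  set M := D' * X with hMdef
  have hMM : M * Mᴴ = P.gram := by
    rw [hMdef, conjTranspose_mul, hX.1, hD'h]
    calc D' * X * (X * D') = D' * (X * X) * D' := by simp only [Matrix.mul_assoc]
      _ = (D' * D) * P.gram * (D * D') := by rw [h.eq, ← hD]; simp only [Matrix.mul_assoc]
      _ = P.gram := by rw [e1, e2, Matrix.one_mul, Matrix.mul_one]
  have hMu : IsUnit M.det := by
    have := posDef_isUnit_det P.gram_posDef
    rw [← hMM, det_mul] at this
    exact isUnit_of_mul_isUnit_left this
  have hMhu : IsUnit Mᴴ.det := by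
    rw [det_conjTranspose]
    exact hMu.star
  have hSu := posDef_isUnit_det (msqrt_posDef P.gram_posDef)
  have hSh : ((msqrt P.gram)⁻¹)ᴴ = (msqrt P.gram)⁻¹ := (msqrt_posDef P.gram_posDef).inv.1
  set W := (msqrt P.gram)⁻¹ * M with hW
  have hSW : msqrt P.gram * W = M := by
    rw [hW, ← Matrix.mul_assoc, mul_nonsing_inv _ hSu, Matrix.one_mul]
  have hon : Orthonormal ℂ fun i => ∑ j, M j i • P.u j := by
    rw [orthonormal_iff_ite]
    intro i k
    rw [P.inner_sum_u_sum_u, ← hMM, Matrix.mul_inv_rev, ← Matrix.mul_assoc Mᴴ,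
      mul_nonsing_inv _ hMhu, Matrix.one_mul, nonsing_inv_mul _ hMu, one_apply]
  have := Module.Basis.finiteDimensional_of_finite (Module.Basis.mk P.indep P.span_top.ge)
  have hspan : Submodule.span ℂ (Set.range fun i => ∑ j, M j i • P.u j) = ⊤ :=
    hon.linearIndependent.span_eq_top_of_card_eq_finrank' (by
      rw [Fintype.card_fin, P.finrank_eq])
  set w := OrthonormalBasis.mk hon hspan.ge with hw
  have hwi : ∀ i, w i = ∑ j, M j i • P.u j := fun i => by rw [hw, OrthonormalBasis.coe_mk]
  have hMapp : ∀ i j, M i j = (((d i)⁻¹ : ℝ) : ℂ) * X i j := fun i j => diagonal_mul _ _ _ _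
  have hMii : ∀ i, M i i = (d i : ℂ) := by
    intro i
    have : (d i : ℂ) ≠ 0 := by exact_mod_cast (hd i).ne'
    rw [hMapp, h.diag]
    push_cast
    field_simp
  have hin : ∀ k i, inner ℂ (P.tilde k) (w i) = M k i := fun k i => by
    rw [hwi, P.inner_tilde_sum_u]
  have hDX : D * M = X := by
    rw [hMdef, ← Matrix.mul_assoc, e1, Matrix.one_mul]
  have hdM : ∀ i j, (d i : ℂ) * M i j = X i j := fun i j => by
    rw [← hDX, hD, diagonal_mul]
  refine ⟨w, W, ⟨?_, ?_, ?_, ?_, ?_⟩, ?_⟩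
  · rw [Matrix.mem_unitaryGroup_iff, star_eq_conjTranspose, hW, conjTranspose_mul, hSh]
    calc (msqrt P.gram)⁻¹ * M * (Mᴴ * (msqrt P.gram)⁻¹)
        = (msqrt P.gram)⁻¹ * (M * Mᴴ) * (msqrt P.gram)⁻¹ := by simp only [Matrix.mul_assoc]
      _ = ((msqrt P.gram)⁻¹ * msqrt P.gram) * (msqrt P.gram * (msqrt P.gram)⁻¹) := by
          rw [hMM]
          nth_rewrite 2 [← msqrt_mul_self P.gram_posDef.posSemidef]
          simp only [Matrix.mul_assoc]
      _ = 1 := by rw [nonsing_inv_mul _ hSu, mul_nonsing_inv _ hSu, Matrix.one_mul]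
  · rw [hSW]; exact hwi
  · intro i; rw [hSW, hMii, Complex.ofReal_im]
  · intro i; rw [hSW, hMii, Complex.ofReal_re]; exact (hd i).le
  · rw [P.slack_proj_iff]
    intro i j
    simp only [← inner_conj_symm (w _) (P.tilde _), hin]
    rw [hMii, hMii, Complex.conj_ofReal, hdM, mul_comm, ← hX.1.apply j i, ← hdM i j,
      RCLike.star_def, map_mul, Complex.conj_ofReal]
  · rw [Ensemble.X, Ensemble.D, hSW, Matrix.mul_assoc, hSW]
    simp only [hMii]
    exact hDX

/-- Rank-one projective solutions with the same measurement agree, if the diagonal of one of them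
does not vanish. -/
theorem IsProjSolution.X_eq_of_proj_eq {P : Ensemble n H} {w w' : OrthonormalBasis (Fin n) ℂ H}
    {W W' : Matrix (Fin n) (Fin n) ℂ} (h : P.IsProjSolution w W) (h' : P.IsProjSolution w' W')
    (hd : ∀ i, 0 < ((msqrt P.gram * W') i i).re) (hp : proj w = proj w') : P.X W = P.X W' := by
  have hM : msqrt P.gram * W = msqrt P.gram * W' := by
    ext k i
    -- Equal projections leave only a phase `a` between the vectors; it is also a ratio of
    -- nonnegative diagonal entries, hence `1`.
    have hv : w i = inner ℂ (w' i) (w i) • w' i := by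
      have h1 := congrArg (fun F => F (w i)) (congrFun hp i)
      simp only [proj, ketbra, InnerProductSpace.rankOne_apply] at h1
      rw [inner_self_eq_norm_sq_to_K, w.orthonormal.1 i] at h1
      simpa using h1
    set a : ℂ := inner ℂ (w' i) (w i) with ha
    have hna : ‖a‖ = 1 := by
      have := congrArg norm hv
      rw [norm_smul, w.orthonormal.1 i, w'.orthonormal.1 i, mul_one] at this
      exact this.symm
    have hk : ∀ k, (msqrt P.gram * W) k i = a * (msqrt P.gram * W') k i := fun k => by
      rw [← h.inner_tilde, ← h'.inner_tilde, hv, inner_smul_right]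
    have hi := hk i
    rw [h.diag_eq, h'.diag_eq] at hi
    have hr := hd i
    have hr0 := h.diag_re i
    set r := ((msqrt P.gram * W) i i).re
    set r' := ((msqrt P.gram * W') i i).re
    have hr' : (r' : ℂ) ≠ 0 := by exact_mod_cast hr.ne'
    have haa : a = ((r / r' : ℝ) : ℂ) := by
      rw [Complex.ofReal_div, eq_div_iff hr', ← hi]
    have h1 : r / r' = 1 := by
      rw [haa, Complex.norm_real, Real.norm_of_nonneg (by positivity)] at hna
      exact hna
    rw [hk, haa, h1, Complex.ofReal_one, one_mul]
  rw [Ensemble.X, Ensemble.X, Ensemble.D, Ensemble.D, Matrix.mul_assoc, Matrix.mul_assoc, hM]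

/-- The positive definite solution has the only optimal measurement, so the given one must share its
`X`. -/
theorem IsProjSolution.posDef_of_isOptimal {P : Ensemble n H} {w : OrthonormalBasis (Fin n) ℂ H}
    {W : Matrix (Fin n) (Fin n) ℂ} (h : P.IsProjSolution w W) (ho : P.IsOptimal (proj w)) :
    (P.X W).PosDef := by
  obtain ⟨X, d, hs, hX⟩ := IsMatrixSolution.exists_posDef P.gram_posDef
  obtain ⟨w', W', h', rfl⟩ := P.exists_isProjSolution hs hX
  rw [h.X_eq_of_proj_eq h' (h'.d_pos hX) (h'.eq_proj_of_isOptimal hX ho)]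
  exact hX

end Ensemble

end EnsembleTheory

/-! ### The pretty good measurement of the reweighted ensemble -/

section PrettyGood

open Matrix

variable {n : ℕ} {H : Type*} [NormedAddCommGroup H] [InnerProductSpace ℂ H]

theorem isPositive_of_opMatrix (w : OrthonormalBasis (Fin n) ℂ H) {F : H →L[ℂ] H}
    (hF : (opMatrix w F).PosSemidef) : F.IsPositive := by
  have hn : ∀ v, 0 ≤ inner ℂ v (F v) := by
    intro v
    have h := hF.dotProduct_mulVec_nonneg (fun k => inner ℂ (w k) v)
    rw [inner_apply_eq_sum w]
    convert h using 1
    simp only [dotProduct, mulVec, Finset.mul_sum, Pi.star_apply]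
    refine Finset.sum_congr rfl fun k _ => Finset.sum_congr rfl fun l _ => ?_
    rw [RCLike.star_def, inner_conj_symm]
    ring
  rw [ContinuousLinearMap.isPositive_iff_complex]
  intro v
  have h : 0 ≤ inner ℂ (F v) v := by
    rw [← inner_conj_symm]
    exact star_nonneg_iff.2 (hn v)
  have h' := Complex.le_def.1 h
  exact ⟨Complex.ext rfl (by simpa using h'.2), h'.1⟩

namespace Ensemble

/-- A positive operator which maps an orthonormal basis to the subnormalised states is the square
root of the density operator, and the pretty good measurement is that of the basis. -/
theorem pgm_eq_proj [CompleteSpace H] (Q : Ensemble n H) (w : OrthonormalBasis (Fin n) ℂ H)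
    (h : (of fun k l => inner ℂ (w k) (Q.tilde l) : Matrix (Fin n) (Fin n) ℂ).PosSemidef) :
    Q.pgm = proj w := by
  -- `S` sends `w i` to the subnormalised state `i`, so its matrix in `w` is the one assumed
  -- positive, and `S² = ρ`. Its inverse `R`, built from the biorthogonal vectors, sends the states
  -- back to the basis.
  set S : H →L[ℂ] H := ∑ i, InnerProductSpace.rankOne ℂ (Q.tilde i) (w i) with hSdef
  have hSv : ∀ v, S v = ∑ i, inner ℂ (w i) v • Q.tilde i := fun v => by simp [hSdef]
  have hSw : ∀ l, S (w l) = Q.tilde l := by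
    intro l
    simp [hSv, orthonormal_iff_ite.1 w.orthonormal]
  have hSpos : S.IsPositive := by
    refine isPositive_of_opMatrix w ?_
    convert h using 1
    ext k l
    rw [opMatrix, of_apply, of_apply, hSw]
  have hsym : ∀ i v, inner ℂ (w i) (S v) = inner ℂ (Q.tilde i) v := fun i v => by
    rw [← hSw]
    exact (hSpos.isSymmetric (w i) v).symm
  have hSS : S * S = Q.density := by
    ext v
    change S (S v) = _
    rw [hSv, density]
    simp only [hsym, ← Q.ketbra_tilde]
    simp [ketbra]
  set R : H →L[ℂ] H := ∑ i, InnerProductSpace.rankOne ℂ (w i) (Q.u i) with hRdef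
  have hRt : ∀ j, R (Q.tilde j) = w j := by
    intro j
    have : ∀ i, inner ℂ (Q.u i) (Q.tilde j) = if i = j then (1 : ℂ) else 0 := fun i => by
      rw [← inner_conj_symm, Q.inner_tilde_u]
      by_cases hij : i = j
      · simp [hij]
      · simp [hij, Ne.symm hij]
    simp [hRdef, this]
  have hRS : R * S = 1 := by
    ext v
    change R (S v) = v
    rw [hSv, map_sum]
    simp only [map_smul, hRt]
    exact w.sum_repr' v
  have hSsa : star S = S := hSpos.isSelfAdjoint
  have hSR : S * R = 1 := by
    have h1 : S * star R = 1 := by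
      have := congrArg star hRS
      rwa [star_mul, hSsa, star_one] at this
    rwa [← left_inv_eq_right_inv hRS h1] at h1
  have hinv : Ring.inverse (CFC.sqrt Q.density) = R := by
    rw [CFC.sqrt_unique hSS ((ContinuousLinearMap.nonneg_iff_isPositive S).2 hSpos)]
    exact Ring.inverse_unit (⟨S, R, hSR, hRS⟩ : (H →L[ℂ] H)ˣ)
  funext i
  rw [pgm, hinv, ← Q.ketbra_tilde]
  ext v
  change R (ketbra (Q.tilde i) (R v)) = _
  have hv : S (R v) = v := congrArg (fun F => F v) hSR
  rw [ketbra, InnerProductSpace.rankOne_apply, map_smul, hRt, ← hsym, hv]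
  rfl

/-- The ensemble of the same states with a priori probabilities proportional to `d i ^ 2 * p i`. -/
def reweight (P : Ensemble n H) (d : Fin n → ℝ) (hd : ∀ i, 0 < d i) {c : ℝ} (hc : 0 < c)
    (hsum : ∑ i, d i ^ 2 * P.p i = c ^ 2) : Ensemble n H where
  p i := d i ^ 2 * P.p i / c ^ 2
  ψ := P.ψ
  p_pos i := div_pos (mul_pos (pow_pos (hd i) 2) (P.p_pos i)) (pow_pos hc 2)
  p_sum := by rw [← Finset.sum_div, hsum, div_self (pow_pos hc 2).ne']
  norm_ψ := P.norm_ψ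
  indep := P.indep
  span_top := P.span_top

theorem tilde_reweight (P : Ensemble n H) (d : Fin n → ℝ) (hd : ∀ i, 0 < d i) {c : ℝ} (hc : 0 < c)
    (hsum : ∑ i, d i ^ 2 * P.p i = c ^ 2) (i : Fin n) :
    (P.reweight d hd hc hsum).tilde i = ((d i / c : ℝ) : ℂ) • P.tilde i := by
  have h : √(d i ^ 2 * P.p i / c ^ 2) = d i / c * √(P.p i) := by
    rw [show d i ^ 2 * P.p i / c ^ 2 = (d i / c) ^ 2 * P.p i by ring,
      Real.sqrt_mul (sq_nonneg _), Real.sqrt_sq (div_pos (hd i) hc).le]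
  change ((√(d i ^ 2 * P.p i / c ^ 2) : ℝ) : ℂ) • P.ψ i = _
  rw [h, Complex.ofReal_mul, mul_smul]
  rfl

theorem gram_reweight (P : Ensemble n H) (d : Fin n → ℝ) (hd : ∀ i, 0 < d i) {c : ℝ} (hc : 0 < c)
    (hsum : ∑ i, d i ^ 2 * P.p i = c ^ 2) (i j : Fin n) :
    (P.reweight d hd hc hsum).gram i j = ((d i / c : ℝ) : ℂ) * P.gram i j * ((d j / c : ℝ) : ℂ) := by
  rw [gram, Matrix.gram_apply, tilde_reweight, tilde_reweight, inner_smul_left, inner_smul_right,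
    Complex.conj_ofReal, gram, Matrix.gram_apply]
  ring

theorem IsProjSolution.exists_pgm_eq [CompleteSpace H] {P : Ensemble n H}
    {w : OrthonormalBasis (Fin n) ℂ H} {W : Matrix (Fin n) (Fin n) ℂ} (h : P.IsProjSolution w W)
    (hX : (P.X W).PosDef) :
    ∃ Q : Ensemble n H, Q.ψ = P.ψ ∧ Q.gram = RG P.gram ∧ Q.pgm = proj w ∧
      0 < normConst Q.gram ∧ P.X W = (normConst Q.gram : ℂ) • msqrt Q.gram := by
  have hs := h.isMatrixSolution
  have hd := h.d_pos hX
  obtain ⟨hpos, hmem⟩ := hs.normalized_mem hX P.gram_mem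
  obtain ⟨hsq, hn, -⟩ := hs.normalized_props hX P.gram_mem
  set X := P.X W with hXdef
  set d : Fin n → ℝ := fun i => ((msqrt P.gram * W) i i).re with hddef
  set c := √((X * X).trace.re) with hcdef
  have hc : 0 < c := Real.sqrt_pos.2 hpos
  have hc0 : (c : ℂ) ≠ 0 := by exact_mod_cast hc.ne'
  have hc2 : (X * X).trace.re = c ^ 2 := (Real.sq_sqrt hpos.le).symm
  have hsum : ∑ i, d i ^ 2 * P.p i = c ^ 2 := by
    rw [← hc2, trace, Complex.re_sum]
    refine Finset.sum_congr rfl fun i _ => ?_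
    rw [diag_apply, hs.mul_self_apply, P.gram_apply_self, ← Complex.ofReal_mul,
      ← Complex.ofReal_mul, Complex.ofReal_re]
    ring
  have hgram : (P.reweight d hd hc hsum).gram = ((((X * X).trace.re)⁻¹ : ℝ) : ℂ) • (X * X) := by
    ext i j
    rw [gram_reweight, Matrix.smul_apply, hs.mul_self_apply, hc2, smul_eq_mul]
    push_cast
    field_simp
  refine ⟨P.reweight d hd hc hsum, rfl, ?_, ?_, ?_, ?_⟩
  -- The weights `d i ^ 2 * p i / c ^ 2` are the diagonal of `X² / Tr X²`. With them the overlaps of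
  -- `w k` with the subnormalised states are `X k l / c`, a positive matrix.
  · rw [hgram, hs.RG_eq hX P.gram_mem]
  · refine pgm_eq_proj _ w ?_
    convert smul_posSemidef hX.posSemidef (inv_nonneg.2 hc.le) using 1
    ext k l
    rw [of_apply, tilde_reweight, inner_smul_right, ← inner_conj_symm, h.inner_tilde,
      Matrix.smul_apply, ← hX.1.apply k l, hXdef, h.X_apply, RCLike.star_def, map_mul,
      Complex.conj_ofReal, smul_eq_mul]
    push_cast
    ring
  · rw [hgram, hn]
    exact hc
  · rw [hgram, hn, hsq, smul_smul, ← Complex.ofReal_mul, mul_inv_cancel₀ hc.ne',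
      Complex.ofReal_one, one_smul]

end Ensemble

end PrettyGood

end MED

end

open MED in
theorem theorem1 {n : ℕ} {H : Type*} [NormedAddCommGroup H] [InnerProductSpace ℂ H]
    [CompleteSpace H] (P : Ensemble n H) :
    -- the map `R_G` is well defined
    Set.BijOn (RGinv (n := n)) (gramSet n) (gramSet n) ∧
    -- the optimal measurement exists, is unique, and comes from a rank-one projective solution
    (∃! E : Fin n → H →L[ℂ] H, P.IsOptimal E) ∧
    (∃ w W, P.IsProjSolution w W ∧ P.IsOptimal (proj w)) ∧
    -- rank-one projective solutions of the complementary slackness conditions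
    (∀ w W, P.IsProjSolution w W →
      IsMatrixSolution P.gram (P.X W) (fun i => ((msqrt P.gram * W) i i).re) ∧
      (P.IsOptimal (proj w) ↔ (P.X W).PosDef) ∧
      (P.IsOptimal (proj w) →
        ∃ Q : Ensemble n H, Q.ψ = P.ψ ∧ Q.gram = RG P.gram ∧ Q.pgm = proj w ∧
          0 < normConst Q.gram ∧ P.X W = (normConst Q.gram : ℂ) • msqrt Q.gram ∧
          RG P.gram = ((P.D W ^ 2 * P.gram).trace)⁻¹ • (P.D W * P.gram * P.D W))) ∧
    -- arbitrary Hermitian solutions of the matrix equation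
    (∀ X d, IsMatrixSolution P.gram X d →
      (X.PosDef ↔ ∃ w W, P.IsProjSolution w W ∧ P.X W = X ∧ P.IsOptimal (proj w)) ∧
      (X.PosDef →
        RG P.gram =
          ((Matrix.diagonal (fun i => (d i : ℂ)) ^ 2 * P.gram).trace)⁻¹ •
            (Matrix.diagonal (fun i => (d i : ℂ)) * P.gram *
              Matrix.diagonal (fun i => (d i : ℂ))))) := by
  obtain ⟨X₀, d₀, hs₀, hX₀⟩ := IsMatrixSolution.exists_posDef P.gram_posDef
  obtain ⟨w₀, W₀, h₀, rfl⟩ := P.exists_isProjSolution hs₀ hX₀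
  have ho₀ := h₀.isOptimal_of_posDef hX₀
  refine ⟨bijOn_RGinv, ⟨proj w₀, ho₀, fun E hE => h₀.eq_proj_of_isOptimal hX₀ hE⟩,
    ⟨w₀, W₀, h₀, ho₀⟩, fun w W h => ⟨h.isMatrixSolution,
      ⟨h.posDef_of_isOptimal, h.isOptimal_of_posDef⟩, fun ho => ?_⟩,
    fun X d hs => ⟨⟨fun hX => ?_, ?_⟩, fun hX => hs.RG_eq_diagonal hX P.gram_mem⟩⟩
  · have hX := h.posDef_of_isOptimal ho
    obtain ⟨Q, h1, h2, h3, h4, h5⟩ := h.exists_pgm_eq hX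
    refine ⟨Q, h1, h2, h3, h4, h5, ?_⟩
    rw [h.D_eq]
    exact h.isMatrixSolution.RG_eq_diagonal hX P.gram_mem
  · obtain ⟨w, W, h, rfl⟩ := P.exists_isProjSolution hs hX
    exact ⟨w, W, h, rfl, h.isOptimal_of_posDef hX⟩
  · rintro ⟨w, W, h, rfl, ho⟩
    exact h.posDef_of_isOptimal ho
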